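/- Consider a single-server queue in a random environment. The environment $Z$ is an irreducible continuous-time Markov chain on $\{1,\dots,D\}$ with generator $Q$ and invariant distribution $\pi$. While the environment is in state $d$, customers arrive according to a Poisson process of rate $\lambda_d\ge 0$ and the server works at rate $c_d\ge 0$. A customer that arrives in state $d$ has a service requirement with distribution $H_d$ on $[0,\infty)$, which does not change afterwards; $h_{d1}$ and $h_{d2}$ are the first and second moments of $H_d$, assumed finite. Requirements, arrivals and environment are independent apart from this modulation. The service discipline is an arbitrary work-conserving one (for instance, any that does not depend on the state of the environment): as long as there is unfinished work, the whole capacity is divided among the customers with unfinished work. The workload $W$ is the total residual service requirement of the customers in the system, which is depleted at rate $c_d$ while it is positive and the environment is in state $d$. Put $$c_\infty=\sum_d\pi_d c_d,\qquad \rho_\infty=\frac1{c_\infty}\sum_d \pi_d\lambda_d h_{d1},$$ and assume $c_\infty>0$. Suppose that $(W,Z)$ is in steady state, and let $p_{0,d}=\mathbb P(W=0,\,Z=d)$. Then $$1-\rho_\infty=\sum_{d}\frac{p_{0,d}\,c_d}{c_\infty}.$$ The system of equations $$[Qa]_d=c_d-\lambda_d h_{d1}-c_\infty(1-\rho_\infty),\qquad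 d=1,\dots,D,$$ has a solution $a\in\mathbb R^D$. If moreover $\rho_\infty<1$, then $\mathbb E W<\infty$ and, for every such solution $a$, $$\mathbb E W=\frac{\sum_{d}\bigl[\pi_d\lambda_d h_{d2}/2+a_d\pi_d(\lambda_d h_{d1}-c_d)+p_{0,d}\,c_d\,a_d\bigr]}{c_\infty(1-\rho_\infty)}.$$ -/

import Mathlib

open MeasureTheory ProbabilityTheory

noncomputable section

/-- Parameters of a single-server queue in a finite Markovian random environment with states
`Fin D`: the generator `Q` of the (irreducible) environment, and for every state `d` the arrival
rate `lam d`, the service capacity `c d` and the law `H d` on `[0, ∞)` of the service requirement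
of a customer that arrives in state `d`, with finite first and second moments. -/
structure ModulatedQueue (D : ℕ) where
  Q : Matrix (Fin D) (Fin D) ℝ
  lam : Fin D → ℝ
  c : Fin D → ℝ
  H : Fin D → Measure ℝ
  Q_offDiag : ∀ d l, d ≠ l → 0 ≤ Q d l
  Q_rowSum : ∀ d, ∑ l, Q d l = 0
  Q_irreducible : ∀ d l, Relation.ReflTransGen (fun i j => 0 < Q i j) d l
  lam_nonneg : ∀ d, 0 ≤ lam d
  c_nonneg : ∀ d, 0 ≤ c d
  H_prob : ∀ d, IsProbabilityMeasure (H d)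
  H_nonneg : ∀ d, H d (Set.Iio 0) = 0
  H_first : ∀ d, Integrable (fun x : ℝ => x) (H d)
  H_second : ∀ d, Integrable (fun x : ℝ => x ^ 2) (H d)

/-- The primitive random variables that drive the queue: `interarrival d n` and `switch d l n` are
the successive gaps of unit-rate Poisson processes (one for the arrivals in state `d`, one for the
environment transitions `d → l`), `requirement d n` is the service requirement that belongs to the
`n`-th point of the arrival process of state `d`. -/
inductive Source (D : ℕ) : Type
  | interarrival (d : Fin D) (n : ℕ)
  | requirement (d : Fin D) (n : ℕ)
  | switch (d l : Fin D) (n : ℕ)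

/-- Customers: `Sum.inl i` are those present at time `0`; `Sum.inr (d, n)` is the customer that
belongs to the `n`-th point of the arrival process of state `d` (it joins the queue only if the
environment is in state `d` at that point). -/
abbrev Customer (D : ℕ) : Type := ℕ ⊕ (Fin D × ℕ)

/-- `RingsAt rate gap n t`: the `n`-th point (`n = 0, 1, …`) of the Poisson process of rate `rate`
that is built from the unit-rate gaps `gap` lies at time `t`, that is, `t` is the sum of the first
`n + 1` gaps divided by `rate`. A process of rate `0` has no points. -/
def RingsAt (rate : ℝ) (gap : ℕ → ℝ) (n : ℕ) (t : ℝ) : Prop :=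
  rate * t = ∑ i ∈ Finset.range (n + 1), gap i

namespace ModulatedQueue

variable {D : ℕ} (m : ModulatedQueue D)

/-- `π` is an invariant distribution of the environment. -/
def IsInvariantDistribution (π : Fin D → ℝ) : Prop :=
  (∀ d, 0 ≤ π d) ∧ ∑ d, π d = 1 ∧ ∀ l, ∑ d, π d * m.Q d l = 0

/-- First moment of the service requirement in state `d`. -/
def h1 (d : Fin D) : ℝ := ∫ x, x ∂(m.H d)

/-- Second moment of the service requirement in state `d`. -/
def h2 (d : Fin D) : ℝ := ∫ x, x ^ 2 ∂(m.H d)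

/-- Average service capacity. -/
def cInf (π : Fin D → ℝ) : ℝ := ∑ d, π d * m.c d

/-- Traffic intensity. -/
def rhoInf (π : Fin D → ℝ) : ℝ := (∑ d, π d * m.lam d * m.h1 d) / m.cInf π

/-- The equation `[Q a]_d = c_d - λ_d h_{d1} - c_∞ (1 - ρ_∞)` for all `d`. -/
def SolvesQ (π a : Fin D → ℝ) : Prop :=
  ∀ d, ∑ l, m.Q d l * a l = m.c d - m.lam d * m.h1 d - m.cInf π * (1 - m.rhoInf π)

/-- The laws of the primitive random variables. -/
def sourceLaw : Source D → Measure ℝ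
  | .interarrival _ _ => expMeasure 1
  | .requirement d _ => m.H d
  | .switch _ _ _ => expMeasure 1

/-- The queue with parameters `m` on the time axis `[0, ∞)`, on the probability space `(Ω, P)`,
under an arbitrary work-conserving service discipline. -/
structure Realization {Ω : Type*} [MeasurableSpace Ω] (P : Measure Ω) where
  /-- primitive random variables -/
  X : Source D → Ω → ℝ
  /-- residual requirements of the customers present at time `0` -/
  init : ℕ → Ω → ℝ
  /-- environment -/
  Z : ℝ → Ω → Fin D
  /-- residual service requirement of each customer (`0` before arrival and after departure) -/
  R : Customer D → ℝ → Ω → ℝ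
  /-- the service discipline: fraction of the capacity that is given to each customer -/
  share : Customer D → ℝ → Ω → ℝ
  X_measurable : ∀ i, Measurable (X i)
  X_law : ∀ i, P.map (X i) = m.sourceLaw i
  X_indep : iIndepFun X P
  init_measurable : ∀ i, Measurable (init i)
  Z_zero_measurable : Measurable (Z 0)
  /-- the state at time `0` is independent of the primitive random variables -/
  init_indep : IndepFun (fun ω => ((fun i => init i ω), Z 0 ω)) (fun ω i => X i ω) P
  init_nonneg : ∀ᵐ ω ∂P, ∀ i, 0 ≤ init i ω
  init_finite : ∀ᵐ ω ∂P, {i | init i ω ≠ 0}.Finite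
  /-- the environment stays in `d` as long as none of the processes `d → l` has a point -/
  Z_hold : ∀ᵐ ω ∂P, ∀ s t d, 0 ≤ s → s ≤ t → Z s ω = d →
    (∀ l, l ≠ d → ∀ n, ∀ u ∈ Set.Ioc s t,
      ¬ RingsAt (m.Q d l) (fun i => X (.switch d l i) ω) n u) →
    Z t ω = d
  /-- if it is in `d` just before a point of the process `d → l`, it moves to `l` -/
  Z_jump : ∀ᵐ ω ∂P, ∀ s t d l n, 0 ≤ s → s < t → (∀ u ∈ Set.Ico s t, Z u ω = d) → l ≠ d →
    RingsAt (m.Q d l) (fun i => X (.switch d l i) ω) n t → Z t ω = l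
  R_nonneg : ∀ᵐ ω ∂P, ∀ j t, 0 ≤ t → 0 ≤ R j t ω
  /-- residual requirement of an initial customer = initial value minus service received -/
  R_init : ∀ᵐ ω ∂P, ∀ i t, 0 ≤ t →
    R (.inl i) t ω = init i ω - ∫ s in (0 : ℝ)..t, m.c (Z s ω) * share (.inl i) s ω
  /-- a customer that has joined by time `t`: requirement minus service received -/
  R_joined : ∀ᵐ ω ∂P, ∀ d n t u, 0 < u → u ≤ t →
    RingsAt (m.lam d) (fun i => X (.interarrival d i) ω) n u → Z u ω = d →
    R (.inr (d, n)) t ω =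
      X (.requirement d n) ω - ∫ s in (0 : ℝ)..t, m.c (Z s ω) * share (.inr (d, n)) s ω
  /-- a customer that has not joined by time `t` -/
  R_notJoined : ∀ᵐ ω ∂P, ∀ d n t, 0 ≤ t →
    (∀ u ∈ Set.Ioc 0 t,
      RingsAt (m.lam d) (fun i => X (.interarrival d i) ω) n u → Z u ω ≠ d) →
    R (.inr (d, n)) t ω = 0
  share_measurable : ∀ᵐ ω ∂P, ∀ j, Measurable (fun s => share j s ω)
  share_nonneg : ∀ᵐ ω ∂P, ∀ j s, 0 ≤ s → 0 ≤ share j s ω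
  /-- only customers with unfinished work are served -/
  share_eq_zero : ∀ᵐ ω ∂P, ∀ j s, 0 ≤ s → R j s ω = 0 → share j s ω = 0
  /-- the whole capacity is used whenever there is unfinished work -/
  share_sum : ∀ᵐ ω ∂P, ∀ s, 0 ≤ s → (∃ j, 0 < R j s ω) → HasSum (fun j => share j s ω) 1

namespace Realization

variable {m} {Ω : Type*} [MeasurableSpace Ω] {P : Measure Ω} (S : m.Realization P)

/-- The workload at time `t`: the total residual service requirement in the system. -/
def W (t : ℝ) (ω : Ω) : ℝ := ∑' j, S.R j t ω

/-- The process `(W, Z)` is in steady state. -/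
def IsStationary : Prop :=
  ∀ t, 0 ≤ t →
    IdentDistrib (fun ω => (S.W t ω, S.Z t ω)) (fun ω => (S.W 0 ω, S.Z 0 ω)) P P

/-- `P(W = 0, Z = d)` in steady state. -/
def p0 (d : Fin D) : ℝ := P.real {ω | S.W 0 ω = 0 ∧ S.Z 0 ω = d}

end Realization

end ModulatedQueue

end

/-!
Whatever the discipline, the workload falls from `W` to `max (W - c_d t) 0` during a time `t` that
the environment spends in state `d` without arrivals, so `(W, Z)` can be treated on its own, by
transforms. Up to an error of order `t ^ 2`, at most one of the Poisson clocks that drive the queue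
rings during `[0, t]`, so the change of `E φ(Z, W)` over `[0, t]` is to first order the sum of the
drain of the workload and, for each clock, its rate times the expected jump of `φ`. In steady state
this change vanishes. With `φ(z, w) = 1_{z = l} exp (s w)` and `s ≤ 0` one obtains for
`E_l(s) = E[exp (s W); Z = l]` the linear system
`∑ d, E_d(s) Q_{dl} = s c_l (E_l(s) - p_{0,l}) - λ_l (E[exp (s B_l)] - 1) E_l(s)`, where `B_l` has
law `H l`. At `s = 0` it says that `E(0) = π`. Summing over `l`, dividing by `s` and letting `s ↑ 0`
gives the formula for `1 - ρ_∞`. Weighting the equations with `a_l` instead cancels the first-order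
terms, so that dividing by `s ^ 2` leaves `c_∞ (1 - ρ_∞) (E[exp (s W)] - 1) / s` on one side and a
convergent expression on the other; Fatou's lemma then gives `E W < ∞`, and dominated convergence
its value.
-/

noncomputable section

/-! ### Irreducible generators -/

section Generator

open Matrix

variable {ι K : Type*} [Fintype ι] [Field K] [LinearOrder K] [IsStrictOrderedRing K]
  {Q : Matrix ι ι K}

/-- The generator (rate matrix) of an irreducible Markov chain on a finite state space. The
diagonal is constrained only by the row sums. -/
structure IsIrreducibleGenerator (Q : Matrix ι ι K) : Prop where
  nonneg_of_ne : ∀ i j, i ≠ j → 0 ≤ Q i j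
  row_sum : ∀ i, ∑ j, Q i j = 0
  irreducible : ∀ i j, Relation.ReflTransGen (fun i j => 0 < Q i j) i j

namespace IsIrreducibleGenerator

lemma eq_of_pos_of_isMax (hQ : IsIrreducibleGenerator Q) {a : ι → K} (ha : Q *ᵥ a = 0) {i j : ι}
    (hmax : ∀ k, a k ≤ a i) (hij : 0 < Q i j) : a j = a i := by
  have hnonneg : ∀ k ∈ Finset.univ, 0 ≤ Q i k * (a i - a k) := fun k _ => by
    rcases eq_or_ne i k with rfl | hik
    · simp
    · exact mul_nonneg (hQ.nonneg_of_ne i k hik) (sub_nonneg.2 (hmax k))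
  have hsum : ∑ k, Q i k * (a i - a k) = 0 := by
    have hi : ∑ k, Q i k * a k = 0 := congrFun ha i
    simp only [mul_sub, Finset.sum_sub_distrib, ← Finset.sum_mul, hQ.row_sum, hi, zero_mul,
      sub_zero]
  have hj := (Finset.sum_eq_zero_iff_of_nonneg hnonneg).1 hsum j (Finset.mem_univ j)
  exact (sub_eq_zero.1 ((mul_eq_zero.1 hj).resolve_left hij.ne')).symm

lemma eq_of_mulVec_eq_zero (hQ : IsIrreducibleGenerator Q) {a : ι → K} (ha : Q *ᵥ a = 0)
    (i j : ι) : a i = a j := by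
  have : Nonempty ι := ⟨i⟩
  obtain ⟨k, hk⟩ := Finite.exists_max a
  have hconst : ∀ l, a l = a k := fun l => by
    induction hQ.irreducible k l with
    | refl => rfl
    | tail _ hij ih => exact (hQ.eq_of_pos_of_isMax ha (fun k' => ih ▸ hk k') hij).trans ih
  rw [hconst i, hconst j]

lemma finrank_ker_mulVecLin_le_one (hQ : IsIrreducibleGenerator Q) :
    Module.finrank K (LinearMap.ker Q.mulVecLin) ≤ 1 := by
  refine finrank_le_one (⟨1, ?_⟩ : LinearMap.ker Q.mulVecLin) fun ⟨a, ha⟩ => ?_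
  · ext i
    simpa [mulVec, dotProduct] using hQ.row_sum i
  · rcases isEmpty_or_nonempty ι with h | ⟨⟨i⟩⟩
    · exact ⟨0, Subtype.ext (Subsingleton.elim _ _)⟩
    · refine ⟨a i, Subtype.ext (funext fun j => ?_)⟩
      simpa using hQ.eq_of_mulVec_eq_zero (by simpa using ha) i j

-- The range of `Q` lies in the hyperplane `π ⬝ᵥ v = 0`, and both have codimension one.
lemma exists_mulVec_eq (hQ : IsIrreducibleGenerator Q) {π v : ι → K} (hπ : π ᵥ* Q = 0)
    (hπ0 : π ≠ 0) (hv : π ⬝ᵥ v = 0) : ∃ a, Q *ᵥ a = v := by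
  classical
  let φ : (ι → K) →ₗ[K] K := dotProductBilin K K π
  have hle : LinearMap.range Q.mulVecLin ≤ LinearMap.ker φ := by
    rintro _ ⟨a, rfl⟩
    simp [φ, dotProduct_mulVec, hπ]
  have hφ : LinearMap.range φ = ⊤ := by
    obtain ⟨i, hi⟩ := Function.ne_iff.1 hπ0
    exact LinearMap.range_eq_top.2 fun r => ⟨Pi.single i (r / π i), by
      simp [φ, mul_div_cancel₀ r hi]⟩
  have hrankQ := LinearMap.finrank_range_add_finrank_ker Q.mulVecLin
  have hrankφ := LinearMap.finrank_range_add_finrank_ker φ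
  rw [hφ, finrank_top, Module.finrank_self] at hrankφ
  have hker := hQ.finrank_ker_mulVecLin_le_one
  have heq := Submodule.eq_of_le_of_finrank_le hle (by omega)
  have hmem : v ∈ LinearMap.range Q.mulVecLin := heq ▸ hv
  exact hmem

lemma eq_of_vecMul_eq_zero (hQ : IsIrreducibleGenerator Q) {π ν : ι → K} (hπ : π ᵥ* Q = 0)
    (hπ1 : ∑ i, π i = 1) (hν : ν ᵥ* Q = 0) (hν1 : ∑ i, ν i = 1) : ν = π := by
  classical
  have hπ0 : π ≠ 0 := by
    rintro rfl
    simp at hπ1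
  funext i
  obtain ⟨a, ha⟩ := hQ.exists_mulVec_eq (v := Pi.single i 1 - π i • 1) hπ hπ0 (by
    simp [dotProduct_sub, dotProduct_one, hπ1])
  have hi : ν ⬝ᵥ (Pi.single i 1 - π i • 1) = 0 := by
    rw [← ha, dotProduct_mulVec, hν, zero_dotProduct]
  simpa [dotProduct_sub, dotProduct_one, hν1, sub_eq_zero] using hi

end IsIrreducibleGenerator

end Generator

namespace ModulatedQueue

open Matrix

variable {D : ℕ} {m : ModulatedQueue D} {π ν : Fin D → ℝ}

lemma isIrreducibleGenerator_Q (m : ModulatedQueue D) : IsIrreducibleGenerator m.Q :=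
  ⟨m.Q_offDiag, m.Q_rowSum, m.Q_irreducible⟩

namespace IsInvariantDistribution

lemma vecMul_eq_zero (hπ : m.IsInvariantDistribution π) : π ᵥ* m.Q = 0 :=
  funext hπ.2.2

lemma unique (hπ : m.IsInvariantDistribution π) (hν : m.IsInvariantDistribution ν) : ν = π :=
  m.isIrreducibleGenerator_Q.eq_of_vecMul_eq_zero hπ.vecMul_eq_zero hπ.2.1 hν.vecMul_eq_zero
    hν.2.1

end IsInvariantDistribution

lemma cInf_mul_one_sub_rhoInf (hc : m.cInf π ≠ 0) :
    m.cInf π * (1 - m.rhoInf π) = ∑ d, π d * (m.c d - m.lam d * m.h1 d) := by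
  rw [rhoInf, mul_sub, mul_div_cancel₀ _ hc, mul_one, cInf, ← Finset.sum_sub_distrib]
  exact Finset.sum_congr rfl fun d _ => by ring

lemma exists_solvesQ (hπ : m.IsInvariantDistribution π) (hc : m.cInf π ≠ 0) :
    ∃ a, m.SolvesQ π a := by
  have hπ0 : π ≠ 0 := by
    rintro rfl
    simpa using hπ.2.1
  obtain ⟨a, ha⟩ := m.isIrreducibleGenerator_Q.exists_mulVec_eq
    (v := fun d => m.c d - m.lam d * m.h1 d - m.cInf π * (1 - m.rhoInf π))
    hπ.vecMul_eq_zero hπ0 (by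
      simp only [dotProduct, mul_sub (π _) (_ - _), Finset.sum_sub_distrib, ← Finset.sum_mul,
        hπ.2.1, cInf_mul_one_sub_rhoInf hc, one_mul, sub_self])
  exact ⟨a, congrFun ha⟩

end ModulatedQueue

/-! ### Transforms of nonnegative random variables -/

section NonposMGF

open Filter Set
open scoped Topology

lemma abs_exp_sub_one_le_abs {y : ℝ} (hy : y ≤ 0) : |Real.exp y - 1| ≤ |y| := by
  rw [abs_of_nonpos hy, abs_of_nonpos (by linarith [Real.exp_le_one_iff.2 hy])]
  linarith [Real.add_one_le_exp y]

lemma abs_exp_sub_one_sub_id_le_sq {y : ℝ} (hy : y ≤ 0) : |Real.exp y - 1 - y| ≤ y ^ 2 := by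
  rcases le_total (-1) y with h | h
  · exact Real.abs_exp_sub_one_sub_id_le (abs_le.2 ⟨h, by linarith⟩)
  · rw [abs_of_nonneg (by linarith [Real.add_one_le_exp y])]
    nlinarith [Real.exp_le_one_iff.2 hy]

lemma lipschitzWith_exp_mul_max {s : ℝ} (hs : s ≤ 0) :
    LipschitzWith ‖s‖₊ fun w => Real.exp (s * max w 0) := by
  have hexp : LipschitzOnWith 1 Real.exp (Iic 0) :=
    (convex_Iic 0).lipschitzOnWith_of_nnnorm_deriv_le (𝕜 := ℝ)
      (fun x _ => Real.differentiableAt_exp) fun x hx => by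
        rw [Real.deriv_exp, ← NNReal.coe_le_coe]
        simpa using hx
  have hmax : LipschitzWith ‖s‖₊ fun w => s * max w 0 := by
    simpa [Function.comp_def] using (lipschitzWith_smul s).comp (LipschitzWith.id.max_const 0)
  rw [← lipschitzOnWith_univ]
  have hmaps : MapsTo (fun w => s * max w 0) univ (Iic 0) := fun w _ =>
    mul_nonpos_of_nonpos_of_nonneg hs (le_max_right w 0)
  simpa [Function.comp_def] using hexp.comp hmax.lipschitzOnWith hmaps

lemma tendsto_inv_mul_exp_mul_sub_one (x : ℝ) :
    Tendsto (fun s => s⁻¹ * (Real.exp (s * x) - 1)) (𝓝[≠] 0) (𝓝 x) := by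
  have h : HasDerivAt (fun s => Real.exp (s * x)) x 0 := by
    simpa using ((hasDerivAt_id (0 : ℝ)).mul_const x).exp
  simpa using h.tendsto_slope_zero

lemma tendsto_inv_sq_mul_exp_mul_sub (x : ℝ) :
    Tendsto (fun s => (s ^ 2)⁻¹ * (Real.exp (s * x) - 1 - s * x)) (𝓝[≠] 0) (𝓝 (x ^ 2 / 2)) := by
  have hlim : Tendsto (fun s : ℝ => s * x) (𝓝[≠] 0) (𝓝 0) :=
    ((continuous_id.mul continuous_const).tendsto' 0 0 (by simp)).mono_left nhdsWithin_le_nhds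
  have ho := ((Real.exp_sub_sum_range_succ_isLittleO_pow 2).comp_tendsto hlim).tendsto_div_nhds_zero
  refine ((ho.mul_const (x ^ 2)).add_const (x ^ 2 / 2)).congr' ?_ |>.trans (by simp)
  filter_upwards [self_mem_nhdsWithin] with s hs
  rcases eq_or_ne x 0 with rfl | hx
  · simp
  · have hs : s ≠ 0 := hs
    simp only [Function.comp_apply, Finset.sum_range_succ, Finset.sum_range_zero]
    simp only [pow_zero, pow_one, Nat.factorial_zero, Nat.factorial_one, Nat.cast_one, div_one]
    field_simp
    ring

variable {Ω : Type*} {mΩ : MeasurableSpace Ω} {μ : Measure Ω} [IsFiniteMeasure μ] {X : Ω → ℝ}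

lemma integrable_exp_mul_of_nonpos {s : ℝ} (hXm : AEMeasurable X μ) (hX : 0 ≤ᵐ[μ] X)
    (hs : s ≤ 0) : Integrable (fun ω => Real.exp (s * X ω)) μ := by
  refine .of_bound (hXm.const_mul s).exp.aestronglyMeasurable 1 (hX.mono fun ω hω => ?_)
  simpa using mul_nonpos_of_nonpos_of_nonneg hs hω

lemma integrable_exp_mul_sub_one {s : ℝ} (hXm : AEMeasurable X μ) (hX : 0 ≤ᵐ[μ] X) (hs : s ≤ 0) :
    Integrable (fun ω => Real.exp (s * X ω) - 1) μ :=
  (integrable_exp_mul_of_nonpos hXm hX hs).sub (integrable_const 1)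

lemma mgf_sub_measureReal_univ {s : ℝ} (hXm : AEMeasurable X μ) (hX : 0 ≤ᵐ[μ] X) (hs : s ≤ 0) :
    mgf X μ s - μ.real univ = ∫ ω, (Real.exp (s * X ω) - 1) ∂μ := by
  rw [integral_sub (integrable_exp_mul_of_nonpos hXm hX hs) (integrable_const 1)]
  simp [mgf]

lemma tendsto_mgf_nhdsLT_zero (hXm : AEMeasurable X μ) (hX : 0 ≤ᵐ[μ] X) :
    Tendsto (mgf X μ) (𝓝[<] 0) (𝓝 (μ.real univ)) := by
  rw [← mgf_zero' (X := X)]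
  refine tendsto_integral_filter_of_norm_le_const
    (.of_forall fun s => (hXm.const_mul s).exp.aestronglyMeasurable) ⟨1, ?_⟩
    (.of_forall fun ω => ?_)
  · filter_upwards [self_mem_nhdsWithin] with s hs
    filter_upwards [hX] with ω hω
    simpa using mul_nonpos_of_nonpos_of_nonneg (le_of_lt hs) hω
  · exact ((Real.continuous_exp.comp (continuous_id.mul continuous_const)).tendsto 0).mono_left
      nhdsWithin_le_nhds

lemma tendsto_inv_mul_mgf_sub (hX : 0 ≤ᵐ[μ] X) (hint : Integrable X μ) :
    Tendsto (fun s => s⁻¹ * (mgf X μ s - μ.real univ)) (𝓝[<] 0) (𝓝 (∫ ω, X ω ∂μ)) := by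
  have h : Tendsto (fun s => ∫ ω, s⁻¹ * (Real.exp (s * X ω) - 1) ∂μ) (𝓝[<] 0)
      (𝓝 (∫ ω, X ω ∂μ)) := by
    refine tendsto_integral_filter_of_dominated_convergence X
      (.of_forall fun s => (((hint.aemeasurable.const_mul s).exp.sub_const 1).const_mul
        s⁻¹).aestronglyMeasurable) ?_ hint
      (.of_forall fun ω => (tendsto_inv_mul_exp_mul_sub_one _).mono_left (nhdsLT_le_nhdsNE 0))
    filter_upwards [self_mem_nhdsWithin] with s (hs : s < 0)
    filter_upwards [hX] with ω hω
    rw [norm_mul, norm_inv, inv_mul_le_iff₀ (norm_pos_iff.2 hs.ne)]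
    calc |Real.exp (s * X ω) - 1| ≤ |s * X ω| :=
          abs_exp_sub_one_le_abs (mul_nonpos_of_nonpos_of_nonneg hs.le hω)
      _ = ‖s‖ * X ω := by rw [abs_mul, Real.norm_eq_abs, abs_of_nonneg hω]
  refine h.congr' ?_
  filter_upwards [self_mem_nhdsWithin] with s hs
  rw [integral_const_mul, mgf_sub_measureReal_univ hint.aemeasurable hX (le_of_lt hs)]

lemma tendsto_inv_sq_mul_mgf_sub (hX : 0 ≤ᵐ[μ] X) (hX2 : MemLp X 2 μ) :
    Tendsto (fun s => (s ^ 2)⁻¹ * (mgf X μ s - μ.real univ - s * ∫ ω, X ω ∂μ)) (𝓝[<] 0)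
      (𝓝 ((∫ ω, X ω ^ 2 ∂μ) / 2)) := by
  have hint : Integrable X μ := hX2.integrable one_le_two
  have h : Tendsto (fun s => ∫ ω, (s ^ 2)⁻¹ * (Real.exp (s * X ω) - 1 - s * X ω) ∂μ) (𝓝[<] 0)
      (𝓝 (∫ ω, X ω ^ 2 / 2 ∂μ)) := by
    refine tendsto_integral_filter_of_dominated_convergence (fun ω => X ω ^ 2)
      (.of_forall fun s => ((((hint.aemeasurable.const_mul s).exp.sub_const 1).sub
        (hint.aemeasurable.const_mul s)).const_mul (s ^ 2)⁻¹).aestronglyMeasurable) ?_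
      hX2.integrable_sq
      (.of_forall fun ω => (tendsto_inv_sq_mul_exp_mul_sub _).mono_left (nhdsLT_le_nhdsNE 0))
    filter_upwards [self_mem_nhdsWithin] with s (hs : s < 0)
    filter_upwards [hX] with ω hω
    rw [norm_mul, norm_inv, Real.norm_of_nonneg (sq_nonneg s),
      inv_mul_le_iff₀ (sq_pos_of_neg hs), ← mul_pow]
    exact abs_exp_sub_one_sub_id_le_sq (mul_nonpos_of_nonpos_of_nonneg hs.le hω)
  rw [integral_div] at h
  refine h.congr' ?_
  filter_upwards [self_mem_nhdsWithin] with s hs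
  rw [integral_const_mul, integral_sub (integrable_exp_mul_sub_one hint.aemeasurable hX
    (le_of_lt hs)) (hint.const_mul s), integral_const_mul,
    mgf_sub_measureReal_univ hint.aemeasurable hX (le_of_lt hs)]

lemma lintegral_enorm_inv_mul_exp_mul_sub_one {s : ℝ} (hXm : AEMeasurable X μ)
    (hX : 0 ≤ᵐ[μ] X) (hs : s ≤ 0) :
    ∫⁻ ω, ‖s⁻¹ * (Real.exp (s * X ω) - 1)‖ₑ ∂μ =
      ENNReal.ofReal (s⁻¹ * (mgf X μ s - μ.real univ)) := by
  have hnonneg : 0 ≤ᵐ[μ] fun ω => s⁻¹ * (Real.exp (s * X ω) - 1) := by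
    filter_upwards [hX] with ω hω
    have := Real.exp_le_one_iff.2 (mul_nonpos_of_nonpos_of_nonneg hs hω)
    exact mul_nonneg_of_nonpos_of_nonpos (inv_nonpos.2 hs) (by linarith)
  rw [mgf_sub_measureReal_univ hXm hX hs, ← integral_const_mul,
    ofReal_integral_eq_lintegral_ofReal ((integrable_exp_mul_sub_one hXm hX hs).const_mul _)
      hnonneg]
  exact lintegral_congr_ae (hnonneg.mono fun ω hω => Real.enorm_of_nonneg hω)

lemma integrable_of_tendsto_inv_mul_mgf_sub (hXm : AEMeasurable X μ) (hX : 0 ≤ᵐ[μ] X) {N : ℝ}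
    (h : Tendsto (fun s => s⁻¹ * (mgf X μ s - μ.real univ)) (𝓝[<] 0) (𝓝 N)) :
    Integrable X μ := by
  obtain ⟨s, -, hs, hs0⟩ := exists_seq_strictMono_tendsto (0 : ℝ)
  have hs' : Tendsto s atTop (𝓝[<] 0) := tendsto_nhdsWithin_iff.2 ⟨hs0, .of_forall hs⟩
  have hlim : ∀ ω, liminf (fun n => ‖(s n)⁻¹ * (Real.exp (s n * X ω) - 1)‖ₑ) atTop = ‖X ω‖ₑ :=
    fun ω => ((tendsto_inv_mul_exp_mul_sub_one _).comp
      (hs'.mono_right (nhdsLT_le_nhdsNE 0))).enorm.liminf_eq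
  refine ⟨hXm.aestronglyMeasurable, ?_⟩
  calc ∫⁻ ω, ‖X ω‖ₑ ∂μ
      ≤ liminf (fun n => ∫⁻ ω, ‖(s n)⁻¹ * (Real.exp (s n * X ω) - 1)‖ₑ ∂μ) atTop := by
        simp only [← hlim]
        exact lintegral_liminf_le' fun n =>
          (((hXm.const_mul _).exp.sub_const 1).const_mul _).enorm
    _ = ENNReal.ofReal N := by
        simp only [fun n => lintegral_enorm_inv_mul_exp_mul_sub_one hXm hX (hs n).le]
        exact ((ENNReal.continuous_ofReal.tendsto N).comp (h.comp hs')).liminf_eq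
    _ < ⊤ := ENNReal.ofReal_lt_top

lemma tendsto_inv_mul_exp_max_sub {s c x : ℝ} (hc : 0 ≤ c) (hx : 0 ≤ x) :
    Tendsto (fun t => t⁻¹ * (Real.exp (s * max (x - c * t) 0) - Real.exp (s * x))) (𝓝[>] 0)
      (𝓝 (-(s * c) * (Real.exp (s * x) - if x = 0 then 1 else 0))) := by
  rcases hx.eq_or_lt with rfl | hx
  · refine tendsto_const_nhds.congr' ?_
    filter_upwards [self_mem_nhdsWithin] with t (ht : 0 < t)
    simp [max_eq_right (neg_nonpos.2 (mul_nonneg hc ht.le))]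
  · have hderiv :
        HasDerivAt (fun t => Real.exp (s * (x - c * t))) (-(s * c) * Real.exp (s * x)) 0 := by
      have h := ((((hasDerivAt_id (0 : ℝ)).const_mul c).const_sub x).const_mul s).exp
      simpa [mul_comm] using h
    have hcont : Continuous fun t => x - c * t := by fun_prop
    have hpos : ∀ᶠ t in 𝓝[>] (0 : ℝ), 0 < x - c * t :=
      nhdsWithin_le_nhds (hcont.continuousAt.eventually (lt_mem_nhds (by simpa using hx)))
    rw [if_neg hx.ne', sub_zero]
    refine hderiv.tendsto_slope_zero_right.congr' ?_
    filter_upwards [hpos] with t ht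
    simp [max_eq_left ht.le]

lemma tendsto_inv_mul_mgf_drain_sub {s c : ℝ} (hXm : Measurable X) (hX : 0 ≤ᵐ[μ] X) (hs : s ≤ 0)
    (hc : 0 ≤ c) :
    Tendsto (fun t => t⁻¹ * (mgf (fun ω => max (X ω - c * t) 0) μ s - mgf X μ s)) (𝓝[>] 0)
      (𝓝 (-(s * c) * (mgf X μ s - μ.real {ω | X ω = 0}))) := by
  have hexp := integrable_exp_mul_of_nonpos hXm.aemeasurable hX hs
  have hexp_max : ∀ t, Integrable (fun ω => Real.exp (s * max (X ω - c * t) 0)) μ := fun t =>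
    integrable_exp_mul_of_nonpos ((hXm.sub_const _).max measurable_const).aemeasurable
      (.of_forall fun ω => le_max_right _ _) hs
  have hzero : MeasurableSet {ω | X ω = 0} := hXm (measurableSet_singleton 0)
  have h : Tendsto
      (fun t => ∫ ω, t⁻¹ * (Real.exp (s * max (X ω - c * t) 0) - Real.exp (s * X ω)) ∂μ) (𝓝[>] 0)
      (𝓝 (∫ ω, -(s * c) * (Real.exp (s * X ω) - {ω | X ω = 0}.indicator 1 ω) ∂μ)) := by
    refine tendsto_integral_filter_of_norm_le_const
      (.of_forall fun t => (((hexp_max t).sub hexp).const_mul _).aestronglyMeasurable)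
      ⟨‖s‖ * c, ?_⟩ ?_
    · filter_upwards [self_mem_nhdsWithin] with t (ht : 0 < t)
      filter_upwards [hX] with ω hω
      have hlip := (lipschitzWith_exp_mul_max hs).dist_le_mul (X ω - c * t) (X ω)
      rw [max_eq_left (show 0 ≤ X ω from hω), Real.dist_eq, Real.dist_eq, sub_sub_cancel_left,
        abs_neg, abs_of_nonneg (mul_nonneg hc ht.le), coe_nnnorm] at hlip
      rw [norm_mul, norm_inv, Real.norm_of_nonneg ht.le, inv_mul_le_iff₀ ht, Real.norm_eq_abs]
      linarith
    · filter_upwards [hX] with ω hω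
      simpa [indicator_apply] using tendsto_inv_mul_exp_max_sub hc hω
  have hind : Integrable ({ω | X ω = 0}.indicator (1 : Ω → ℝ)) μ :=
    (integrable_const 1).indicator hzero
  rw [integral_const_mul, integral_sub hexp hind, integral_indicator_one hzero] at h
  refine h.congr fun t => ?_
  rw [integral_const_mul, integral_sub (hexp_max t) hexp]
  rfl

end NonposMGF

section Independence

variable {Ω α β γ : Type*} [MeasurableSpace Ω] [MeasurableSpace α] [MeasurableSpace β]
  [MeasurableSpace γ] {P : Measure Ω} [IsProbabilityMeasure P]

lemma indepFun_prodMk_of_indepFun_prodMk {U : Ω → α} {A : Ω → β} {B : Ω → γ} (hU : Measurable U)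
    (hA : Measurable A) (hB : Measurable B) (hUAB : IndepFun U (fun ω => (A ω, B ω)) P)
    (hAB : IndepFun A B P) : IndepFun A (fun ω => (U ω, B ω)) P := by
  have hUB : IndepFun U B P := hUAB.comp measurable_id measurable_snd
  have := Measure.isProbabilityMeasure_map (μ := P) hU.aemeasurable
  have := Measure.isProbabilityMeasure_map (μ := P) hA.aemeasurable
  have := Measure.isProbabilityMeasure_map (μ := P) hB.aemeasurable
  have hmp : MeasurePreserving (fun x : α × β × γ => (x.2.1, x.1, x.2.2))
      ((P.map U).prod ((P.map A).prod (P.map B))) ((P.map A).prod ((P.map U).prod (P.map B))) :=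
    (measurePreserving_prodAssoc (P.map A) (P.map U) (P.map B)).comp
      ((Measure.measurePreserving_swap.prod (MeasurePreserving.id (P.map B))).comp
        (measurePreserving_prodAssoc (P.map U) (P.map A) (P.map B)).symm)
  have hlaw := hUAB.map_prod_eq_prod_map_map hU.aemeasurable (hA.prodMk hB).aemeasurable
  rw [hAB.map_prod_eq_prod_map_map hA.aemeasurable hB.aemeasurable] at hlaw
  rw [indepFun_iff_map_prod_eq_prod_map_map hA.aemeasurable (hU.prodMk hB).aemeasurable,
    hUB.map_prod_eq_prod_map_map hU.aemeasurable hB.aemeasurable, ← hmp.map_eq, ← hlaw,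
    Measure.map_map hmp.measurable (hU.prodMk (hA.prodMk hB))]
  rfl

end Independence

/-! ### Paths of the workload -/

section Drain

open Set

lemma eq_max_sub_of_drain {w u : ℝ → ℝ} {c t : ℝ} (hc : 0 ≤ c) (ht : 0 ≤ t)
    (hint : IntervalIntegrable u volume 0 t) (hu : ∀ s ∈ Icc 0 t, u s ∈ Icc 0 1)
    (hw : ∀ s ∈ Icc 0 t, w s = w 0 - c * ∫ r in 0..s, u r) (hwt : 0 ≤ w t)
    (hbusy : ∀ s ∈ Icc 0 t, 0 < w s → u s = 1) : w t = max (w 0 - c * t) 0 := by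
  have hwt_eq := hw t (right_mem_Icc.2 ht)
  have hle : ∫ r in 0..t, u r ≤ t := by
    have := intervalIntegral.integral_mono_on ht hint
      (intervalIntegrable_const (c := (1 : ℝ))) fun s hs => (hu s hs).2
    simpa using this
  have hge : w 0 - c * t ≤ w t := by linarith [mul_le_mul_of_nonneg_left hle hc]
  rcases hwt.eq_or_lt with h0 | hpos
  · rw [← h0, max_eq_right (h0 ▸ hge)]
  · have hanti : ∀ s ∈ Icc 0 t, w t ≤ w s := fun s hs => by
      rw [hwt_eq, hw s hs]
      refine sub_le_sub_left (mul_le_mul_of_nonneg_left ?_ hc) _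
      refine intervalIntegral.integral_mono_interval le_rfl hs.1 hs.2 ?_ hint
      exact (ae_restrict_iff' measurableSet_Ioc).2
        (.of_forall fun r hr => (hu r (Ioc_subset_Icc_self hr)).1)
    have hfull : ∫ r in 0..t, u r = t := by
      rw [intervalIntegral.integral_congr (g := fun _ => (1 : ℝ)) fun s hs => ?_]
      · simp
      · rw [uIcc_of_le ht] at hs
        exact hbusy s hs (hpos.trans_le (hanti s hs))
    rw [hfull] at hwt_eq
    rw [← hwt_eq, max_eq_left hpos.le]

end Drain

namespace ModulatedQueue

open Set

variable {D : ℕ} (m : ModulatedQueue D)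

/-- An upper bound for the service capacities; the sum of all of them, so that it also makes sense
for `D = 0`. -/
def cMax : ℝ := ∑ d, m.c d

lemma c_le_cMax (d : Fin D) : m.c d ≤ m.cMax :=
  Finset.single_le_sum (fun i _ => m.c_nonneg i) (Finset.mem_univ d)

lemma cMax_nonneg : 0 ≤ m.cMax := Finset.sum_nonneg fun i _ => m.c_nonneg i

namespace Realization

variable {m} {Ω : Type*} [MeasurableSpace Ω] {P : Measure Ω} (S : m.Realization P)

/-- The service that customer `j` has received by time `t`. -/
def service (j : Customer D) (t : ℝ) (ω : Ω) : ℝ :=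
  ∫ s in (0 : ℝ)..t, m.c (S.Z s ω) * S.share j s ω

/-- The service requirement of a customer; that of a customer present at time `0` is its residual
requirement at that time. -/
def requirement : Customer D → Ω → ℝ
  | .inl i, ω => S.init i ω
  | .inr (d, n), ω => S.X (.requirement d n) ω

/-- Customer `j` has entered the system by time `t`. The indices `i` with `init i = 0` do not stand
for actual customers. -/
def HasEntered : Customer D → ℝ → Ω → Prop
  | .inl i, _, ω => S.init i ω ≠ 0
  | .inr (d, n), t, ω => ∃ u ∈ Ioc 0 t,
      RingsAt (m.lam d) (fun i => S.X (.interarrival d i) ω) n u ∧ S.Z u ω = d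

/-- The workload at time `0`, as a measurable function of the residual requirements `S.init`: for
`S.W 0` itself measurability is not part of the model. -/
def initialWorkload (ω : Ω) : ℝ := (∑' i, ENNReal.ofReal (S.init i ω)).toReal

variable {S} in
lemma HasEntered.mono {j : Customer D} {s t : ℝ} {ω : Ω} (h : S.HasEntered j s ω) (hst : s ≤ t) :
    S.HasEntered j t ω := by
  rcases j with i | ⟨d, n⟩
  · exact h
  · obtain ⟨u, hu, hring⟩ := h
    exact ⟨u, ⟨hu.1, hu.2.trans hst⟩, hring⟩

lemma not_hasEntered_inr_zero (p : Fin D × ℕ) (ω : Ω) : ¬S.HasEntered (.inr p) 0 ω := by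
  rintro ⟨u, hu, -⟩
  exact hu.1.not_ge hu.2

lemma ae_sum_share_le_one :
    ∀ᵐ ω ∂P, ∀ (F : Finset (Customer D)) s, 0 ≤ s → ∑ j ∈ F, S.share j s ω ≤ 1 := by
  filter_upwards [S.R_nonneg, S.share_nonneg, S.share_eq_zero, S.share_sum]
    with ω hR hshare hidle hbusy F s hs
  by_cases hex : ∃ j, 0 < S.R j s ω
  · exact sum_le_hasSum F (fun j _ => hshare j s hs) (hbusy s hs hex)
  · push Not at hex
    rw [Finset.sum_eq_zero fun j _ => hidle j s hs ((hex j).antisymm (hR j s hs))]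
    exact zero_le_one

lemma ae_intervalIntegrable_share :
    ∀ᵐ ω ∂P, ∀ j t, 0 ≤ t → IntervalIntegrable (fun s => S.share j s ω) volume 0 t := by
  filter_upwards [S.share_measurable, S.share_nonneg, S.ae_sum_share_le_one]
    with ω hmeas hshare hsum j t ht
  refine (intervalIntegrable_const (c := (1 : ℝ))).mono_fun' (hmeas j).aestronglyMeasurable ?_
  rw [uIoc_of_le ht]
  refine (ae_restrict_iff' measurableSet_Ioc).2 (.of_forall fun s hs => ?_)
  dsimp only
  rw [Real.norm_of_nonneg (hshare j s hs.1.le)]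
  simpa using hsum {j} s hs.1.le

lemma ae_intervalIntegrable_sum_share : ∀ᵐ ω ∂P, ∀ (F : Finset (Customer D)) t, 0 ≤ t →
    IntervalIntegrable (fun s => ∑ j ∈ F, S.share j s ω) volume 0 t := by
  filter_upwards [S.ae_intervalIntegrable_share] with ω hint F t ht
  have := IntervalIntegrable.sum F fun j _ => hint j t ht
  rwa [Finset.sum_fn] at this

lemma ae_service_nonneg : ∀ᵐ ω ∂P, ∀ j t, 0 ≤ t → 0 ≤ S.service j t ω := by
  filter_upwards [S.share_nonneg] with ω hshare j t ht
  exact intervalIntegral.integral_nonneg ht fun s hs =>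
    mul_nonneg (m.c_nonneg _) (hshare j s hs.1)

lemma ae_service_le :
    ∀ᵐ ω ∂P, ∀ j t, 0 ≤ t → S.service j t ω ≤ m.cMax * ∫ s in (0 : ℝ)..t, S.share j s ω := by
  filter_upwards [S.share_nonneg, S.ae_intervalIntegrable_share] with ω hshare hint j t ht
  rw [← intervalIntegral.integral_const_mul, service, intervalIntegral.integral_of_le ht,
    intervalIntegral.integral_of_le ht]
  refine integral_mono_of_nonneg
    ((ae_restrict_iff' measurableSet_Ioc).2 (.of_forall fun s hs =>
      mul_nonneg (m.c_nonneg _) (hshare j s hs.1.le)))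
    (((intervalIntegrable_iff_integrableOn_Ioc_of_le ht).1 (hint j t ht)).const_mul _)
    ((ae_restrict_iff' measurableSet_Ioc).2 (.of_forall fun s hs =>
      mul_le_mul_of_nonneg_right (m.c_le_cMax _) (hshare j s hs.1.le)))

lemma ae_sum_service_le : ∀ᵐ ω ∂P, ∀ (F : Finset (Customer D)) t, 0 ≤ t →
    ∑ j ∈ F, S.service j t ω ≤ m.cMax * t := by
  filter_upwards [S.ae_service_le, S.ae_intervalIntegrable_share,
    S.ae_intervalIntegrable_sum_share, S.ae_sum_share_le_one] with ω hle hint hintF hsum F t ht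
  have hshare : ∫ s in (0 : ℝ)..t, ∑ j ∈ F, S.share j s ω ≤ t := by
    have := intervalIntegral.integral_mono_on ht (hintF F t ht)
      (intervalIntegrable_const (c := (1 : ℝ))) fun s hs => hsum F s hs.1
    simpa using this
  calc ∑ j ∈ F, S.service j t ω
      ≤ ∑ j ∈ F, m.cMax * ∫ s in (0 : ℝ)..t, S.share j s ω :=
        Finset.sum_le_sum fun j _ => hle j t ht
    _ = m.cMax * ∫ s in (0 : ℝ)..t, ∑ j ∈ F, S.share j s ω := by
        rw [← Finset.mul_sum, intervalIntegral.integral_finsetSum fun j _ => hint j t ht]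
    _ ≤ m.cMax * t := mul_le_mul_of_nonneg_left hshare m.cMax_nonneg

lemma ae_R_eq_sub : ∀ᵐ ω ∂P, ∀ j t, 0 ≤ t → S.HasEntered j t ω →
    S.R j t ω = S.requirement j ω - S.service j t ω := by
  filter_upwards [S.R_init, S.R_joined] with ω hinit hjoined j t ht hj
  rcases j with i | ⟨d, n⟩
  · exact hinit i t ht
  · obtain ⟨u, hu, hring, hZ⟩ := hj
    exact hjoined d n t u hu.1 hu.2 hring hZ

lemma ae_R_eq_zero : ∀ᵐ ω ∂P, ∀ j t, 0 ≤ t → ¬S.HasEntered j t ω → S.R j t ω = 0 := by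
  filter_upwards [S.R_nonneg, S.R_init, S.R_notJoined, S.ae_service_nonneg]
    with ω hR hinit hnot hservice j t ht hj
  rcases j with i | ⟨d, n⟩
  · have hi : S.R (.inl i) t ω = S.init i ω - S.service (.inl i) t ω := hinit i t ht
    have hi0 : S.init i ω = 0 := not_not.1 hj
    linarith [hR (.inl i) t ht, hservice (.inl i) t ht]
  · exact hnot d n t ht fun u hu hring hZ => hj ⟨u, hu, hring, hZ⟩

lemma ae_W_nonneg : ∀ᵐ ω ∂P, ∀ t, 0 ≤ t → 0 ≤ S.W t ω := by
  filter_upwards [S.R_nonneg] with ω hR t ht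
  exact tsum_nonneg fun j => hR j t ht

lemma ae_W_eq_sum : ∀ᵐ ω ∂P, ∀ (F : Finset (Customer D)) t, 0 ≤ t →
    (∀ j, j ∈ F ↔ S.HasEntered j t ω) →
    S.W t ω = ∑ j ∈ F, S.requirement j ω - ∑ j ∈ F, S.service j t ω := by
  filter_upwards [S.ae_R_eq_sub, S.ae_R_eq_zero] with ω hsub hzero F t ht hF
  rw [W, tsum_eq_sum fun j hj => hzero j t ht fun h => hj ((hF j).2 h), ← Finset.sum_sub_distrib]
  exact Finset.sum_congr rfl fun j hj => hsub j t ht ((hF j).1 hj)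

lemma ae_W_mem_Icc : ∀ᵐ ω ∂P, ∀ (F : Finset (Customer D)) t, 0 ≤ t →
    (∀ j, j ∈ F ↔ S.HasEntered j t ω) →
    S.W t ω ∈ Icc (∑ j ∈ F, S.requirement j ω - m.cMax * t) (∑ j ∈ F, S.requirement j ω) := by
  filter_upwards [S.ae_W_eq_sum, S.ae_service_nonneg, S.ae_sum_service_le]
    with ω hW hnonneg hle F t ht hF
  rw [hW F t ht hF]
  exact ⟨sub_le_sub_left (hle F t ht) _,
    sub_le_self _ (Finset.sum_nonneg fun j _ => hnonneg j t ht)⟩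

lemma ae_exists_sum_eq_initialWorkload : ∀ᵐ ω ∂P, ∃ F : Finset (Customer D),
    (∀ j, j ∈ F ↔ S.HasEntered j 0 ω) ∧ ∑ j ∈ F, S.requirement j ω = S.initialWorkload ω := by
  filter_upwards [S.init_finite, S.init_nonneg] with ω hfin hnonneg
  refine ⟨hfin.toFinset.map ⟨Sum.inl, Sum.inl_injective⟩, ?_, ?_⟩
  · rintro (i | p)
    · simp [HasEntered]
    · simpa using S.not_hasEntered_inr_zero p ω
  · rw [Finset.sum_map, initialWorkload, tsum_eq_sum (s := hfin.toFinset),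
      ENNReal.toReal_sum (by simp)]
    · exact Finset.sum_congr rfl fun i _ => (ENNReal.toReal_ofReal (hnonneg i)).symm
    · intro i hi
      simp_all

lemma ae_W_zero_eq_initialWorkload : S.W 0 =ᵐ[P] S.initialWorkload := by
  filter_upwards [S.ae_exists_sum_eq_initialWorkload, S.ae_W_mem_Icc] with ω ⟨F, hF, hV⟩ hW
  simpa [hV] using hW F 0 le_rfl hF

lemma ae_sum_share_eq_one : ∀ᵐ ω ∂P, ∀ (F : Finset (Customer D)) s, 0 ≤ s →
    (∀ j, j ∈ F ↔ S.HasEntered j s ω) → 0 < S.W s ω → ∑ j ∈ F, S.share j s ω = 1 := by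
  filter_upwards [S.ae_R_eq_zero, S.R_nonneg, S.share_eq_zero, S.share_sum]
    with ω hzero hR hidle hbusy F s hs hF hW
  have hex : ∃ j, 0 < S.R j s ω := by
    by_contra! hno
    exact hW.ne' (by simp [W, fun j => (hno j).antisymm (hR j s hs)])
  exact (hasSum_sum_of_ne_finset_zero fun j hj =>
    hidle j s hs (hzero j s hs fun h => hj ((hF j).2 h))).unique (hbusy s hs hex)

lemma ae_W_eq_max : ∀ᵐ ω ∂P, ∀ t, 0 ≤ t → (∀ s ∈ Icc 0 t, S.Z s ω = S.Z 0 ω) →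
    (∀ j, S.HasEntered j t ω → S.HasEntered j 0 ω) →
    S.W t ω = max (S.W 0 ω - m.c (S.Z 0 ω) * t) 0 := by
  filter_upwards [S.ae_exists_sum_eq_initialWorkload, S.ae_W_eq_sum, S.ae_W_nonneg,
    S.ae_intervalIntegrable_share, S.ae_intervalIntegrable_sum_share, S.ae_sum_share_le_one,
    S.share_nonneg, S.ae_sum_share_eq_one]
    with ω ⟨F, hF, _⟩ hW hWnonneg hint hintF hle hshare hbusy t ht hZ hnew
  have hFs : ∀ s ∈ Icc 0 t, ∀ j, j ∈ F ↔ S.HasEntered j s ω := fun s hs j =>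
    (hF j).trans ⟨fun h => h.mono hs.1, fun h => hnew j (h.mono hs.2)⟩
  have hservice : ∀ s ∈ Icc 0 t, ∑ j ∈ F, S.service j s ω =
      m.c (S.Z 0 ω) * ∫ r in (0 : ℝ)..s, ∑ j ∈ F, S.share j r ω := fun s hs => by
    rw [intervalIntegral.integral_finsetSum fun j _ => hint j s hs.1, Finset.mul_sum]
    refine Finset.sum_congr rfl fun j _ => ?_
    rw [← intervalIntegral.integral_const_mul]
    refine intervalIntegral.integral_congr fun r hr => ?_
    rw [uIcc_of_le hs.1] at hr
    simp only [hZ r ⟨hr.1, hr.2.trans hs.2⟩]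
  refine eq_max_sub_of_drain (w := fun s => S.W s ω) (u := fun s => ∑ j ∈ F, S.share j s ω)
    (m.c_nonneg _) ht (hintF F t ht)
    (fun s hs => ⟨Finset.sum_nonneg fun j _ => hshare j s hs.1, hle F s hs.1⟩) (fun s hs => ?_)
    (hWnonneg t ht) fun s hs => hbusy F s hs.1 (hFs s hs)
  rw [hW F s hs.1 (hFs s hs), hW F 0 le_rfl hF, hservice s hs, hservice 0 (left_mem_Icc.2 ht)]
  simp

end Realization

end ModulatedQueue

/-! ### Poisson clocks -/

namespace RingsAt

variable {rate t : ℝ} {gap : ℕ → ℝ} {n : ℕ}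

lemma gap_le (h : RingsAt rate gap n t) (hgap : ∀ i, 0 ≤ gap i) {k : ℕ} (hk : k ≤ n) :
    gap k ≤ rate * t := by
  rw [h]
  exact Finset.single_le_sum (fun i _ => hgap i) (Finset.mem_range_succ_iff.2 hk)

end RingsAt

lemma ringsAt_zero_div {rate : ℝ} (gap : ℕ → ℝ) (hrate : rate ≠ 0) :
    RingsAt rate gap 0 (gap 0 / rate) := by
  simp [RingsAt, mul_div_cancel₀ _ hrate]

/-- The Poisson clocks of the model: one for the arrivals in each state of the environment and one
for each transition. -/
abbrev Clock (D : ℕ) : Type := Fin D ⊕ (Fin D × Fin D)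

namespace Clock

variable {D : ℕ}

/-- The `n`-th unit-rate gap of a clock. -/
def gap : Clock D → ℕ → Source D
  | .inl d, n => .interarrival d n
  | .inr (d, l), n => .switch d l n

/-- The state of the environment in which a clock matters. -/
def state : Clock D → Fin D
  | .inl d => d
  | .inr (d, _) => d

lemma gap_inj {p q : Clock D} {n k : ℕ} : p.gap n = q.gap k ↔ p = q ∧ n = k := by
  rcases p with d | ⟨d, l⟩ <;> rcases q with d' | ⟨d', l'⟩ <;> simp [gap, and_assoc]

lemma gap_ne_requirement (p : Clock D) (n : ℕ) (d : Fin D) (k : ℕ) :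
    p.gap n ≠ .requirement d k := by
  rcases p with d | ⟨d, l⟩ <;> simp [gap]

end Clock

namespace ModulatedQueue

open Set Filter Topology

variable {D : ℕ} (m : ModulatedQueue D)

/-- The rate of a clock. The clocks `d → d`, for which `m.Q d d ≤ 0` is not a rate, never ring. -/
def rate : Clock D → ℝ
  | .inl d => m.lam d
  | .inr (d, l) => max (m.Q d l) 0

lemma rate_nonneg (p : Clock D) : 0 ≤ m.rate p := by
  rcases p with d | ⟨d, l⟩
  · exact m.lam_nonneg d
  · exact le_max_right _ _

lemma rate_switch {d l : Fin D} (h : l ≠ d) : m.rate (.inr (d, l)) = m.Q d l :=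
  max_eq_left (m.Q_offDiag d l h.symm)

namespace Realization

variable {m} {Ω : Type*} [MeasurableSpace Ω] {P : Measure Ω} (S : m.Realization P)

/-- The event that the `k`-th gap of the clock `p` is at most `t` (in the time scale of `p`). -/
def shortGap (p : Clock D) (k : ℕ) (t : ℝ) : Set Ω := {ω | S.X (p.gap k) ω ≤ m.rate p * t}

/-- The event that the clock `p` rings by time `t`, when its first gap is positive. -/
abbrev firstRing (p : Clock D) (t : ℝ) : Set Ω := S.shortGap p 0 t

/-- The event that two of the first two gaps of all clocks are at most `t`. Outside it, at most one
clock rings by time `t`, and this clock rings only once. -/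
def multipleRings (t : ℝ) : Set Ω :=
  ⋃ (x : Clock D × Fin 2) (y : Clock D × Fin 2) (_ : x ≠ y),
    S.shortGap x.1 x.2 t ∩ S.shortGap y.1 y.2 t

lemma shortGap_mono (p : Clock D) (k : ℕ) : Monotone (S.shortGap p k) := fun _ _ hst _ hω =>
  hω.trans (mul_le_mul_of_nonneg_left hst (m.rate_nonneg p))

section GapLaw

lemma map_X_gap (p : Clock D) (k : ℕ) : P.map (S.X (p.gap k)) = expMeasure 1 := by
  rw [S.X_law]
  rcases p with d | ⟨d, l⟩ <;> rfl

lemma measurableSet_shortGap (p : Clock D) (k : ℕ) (t : ℝ) : MeasurableSet (S.shortGap p k t) :=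
  measurableSet_le (S.X_measurable _) measurable_const

lemma measurableSet_multipleRings (t : ℝ) : MeasurableSet (S.multipleRings t) :=
  .iUnion fun x => .iUnion fun y => .iUnion fun _ =>
    (S.measurableSet_shortGap x.1 x.2 t).inter (S.measurableSet_shortGap y.1 y.2 t)

lemma measureReal_X_gap_le (p : Clock D) (k : ℕ) {x : ℝ} (hx : 0 ≤ x) :
    P.real {ω | S.X (p.gap k) ω ≤ x} = 1 - Real.exp (-x) := by
  have := isProbabilityMeasure_expMeasure (r := 1) one_pos
  have hcdf := cdf_expMeasure_eq one_pos x
  rw [cdf_eq_real, ← S.map_X_gap p k,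
    map_measureReal_apply (S.X_measurable _) measurableSet_Iic, if_pos hx, one_mul] at hcdf
  exact hcdf

lemma measureReal_shortGap (p : Clock D) (k : ℕ) {t : ℝ} (ht : 0 ≤ t) :
    P.real (S.shortGap p k t) = 1 - Real.exp (-(m.rate p * t)) :=
  S.measureReal_X_gap_le p k (mul_nonneg (m.rate_nonneg p) ht)

lemma measureReal_shortGap_le (p : Clock D) (k : ℕ) {t : ℝ} (ht : 0 ≤ t) :
    P.real (S.shortGap p k t) ≤ m.rate p * t := by
  rw [S.measureReal_shortGap p k ht]
  linarith [Real.one_sub_le_exp_neg (m.rate p * t)]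

lemma tendsto_inv_mul_measureReal_firstRing (p : Clock D) :
    Tendsto (fun t => t⁻¹ * P.real (S.firstRing p t)) (𝓝[>] 0) (𝓝 (m.rate p)) := by
  have hexp : HasDerivAt (fun t : ℝ => 1 - Real.exp (-(m.rate p * t))) (m.rate p) 0 := by
    simpa using ((hasDerivAt_id (0 : ℝ)).const_mul (m.rate p)).neg.exp.const_sub 1
  refine Tendsto.congr' ?_ hexp.tendsto_slope_zero_right
  filter_upwards [self_mem_nhdsWithin] with t ht
  simp [S.measureReal_shortGap p 0 (mem_Ioi.1 ht).le]

lemma measureReal_shortGap_inter_le {t : ℝ} (ht : 0 ≤ t) {p q : Clock D} {k n : ℕ}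
    (hne : p.gap k ≠ q.gap n) :
    P.real (S.shortGap p k t ∩ S.shortGap q n t) ≤ m.rate p * m.rate q * t ^ 2 := by
  have hprod : P.real (S.shortGap p k t ∩ S.shortGap q n t) =
      P.real (S.shortGap p k t) * P.real (S.shortGap q n t) := by
    simp only [measureReal_def, ← ENNReal.toReal_mul]
    exact congrArg ENNReal.toReal ((S.X_indep.indepFun hne).measure_inter_preimage_eq_mul
      (Iic (m.rate p * t)) (Iic (m.rate q * t)) measurableSet_Iic measurableSet_Iic)
  calc P.real (S.shortGap p k t ∩ S.shortGap q n t)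
      ≤ (m.rate p * t) * (m.rate q * t) := hprod.trans_le <|
        mul_le_mul (S.measureReal_shortGap_le p k ht) (S.measureReal_shortGap_le q n ht)
          measureReal_nonneg (mul_nonneg (m.rate_nonneg p) ht)
    _ = m.rate p * m.rate q * t ^ 2 := by ring

lemma exists_measureReal_multipleRings_le :
    ∃ K, ∀ t, 0 ≤ t → P.real (S.multipleRings t) ≤ K * t ^ 2 := by
  refine ⟨∑ x : Clock D × Fin 2, ∑ y : Clock D × Fin 2, m.rate x.1 * m.rate y.1, fun t ht => ?_⟩
  simp only [Finset.sum_mul]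
  refine (measureReal_iUnion_fintype_le _).trans (Finset.sum_le_sum fun x _ => ?_)
  refine (measureReal_iUnion_fintype_le _).trans (Finset.sum_le_sum fun y _ => ?_)
  rcases eq_or_ne x y with rfl | hxy
  · simpa using mul_nonneg (mul_self_nonneg (m.rate x.1)) (sq_nonneg t)
  · simp only [hxy, ne_eq, not_false_eq_true, iUnion_true]
    refine S.measureReal_shortGap_inter_le ht fun h => hxy ?_
    obtain ⟨h1, h2⟩ := Clock.gap_inj.1 h
    exact Prod.ext h1 (Fin.ext h2)

lemma ae_X_gap_pos [IsFiniteMeasure P] : ∀ᵐ ω ∂P, ∀ (p : Clock D) k, 0 < S.X (p.gap k) ω := by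
  refine ae_all_iff.2 fun p => ae_all_iff.2 fun k => ?_
  have h := S.measureReal_X_gap_le p k le_rfl
  rw [neg_zero, Real.exp_zero, sub_self, measureReal_eq_zero_iff] at h
  simpa [ae_iff] using h

lemma ae_X_requirement_nonneg : ∀ᵐ ω ∂P, ∀ d n, 0 ≤ S.X (.requirement d n) ω := by
  refine ae_all_iff.2 fun d => ae_all_iff.2 fun n => ?_
  refine ae_of_ae_map (S.X_measurable _).aemeasurable (p := fun x => 0 ≤ x) ?_
  simp only [S.X_law, ae_iff, not_le]
  exact m.H_nonneg d

end GapLaw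

/-- The state `(Z, W)` at time `0`, with the measurable version of the workload. -/
def initialState (ω : Ω) : Fin D × ℝ := (S.Z 0 ω, S.initialWorkload ω)

/-- The state to which the first ring of the clock `p` leads from the state at time `0`, the service
received until then being neglected. -/
def afterRing : Clock D → Ω → Fin D × ℝ
  | .inl d, ω => (S.Z 0 ω,
      S.initialWorkload ω + if S.Z 0 ω = d then S.X (.requirement d 0) ω else 0)
  | .inr (d, l), ω => (if S.Z 0 ω = d then l else S.Z 0 ω, S.initialWorkload ω)

section Paths

variable {S} in
lemma eq_of_mem_shortGap {ω : Ω} {t : ℝ} (hω : ω ∉ S.multipleRings t) {p q : Clock D}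
    {k n : Fin 2} (hp : ω ∈ S.shortGap p k t) (hq : ω ∈ S.shortGap q n t) : p = q ∧ k = n := by
  by_contra hne
  refine hω (mem_iUnion.2 ⟨(p, k), mem_iUnion.2 ⟨(q, n), mem_iUnion.2 ⟨?_, hp, hq⟩⟩⟩)
  rwa [ne_eq, Prod.mk.injEq]

variable {S} in
lemma eq_of_mem_firstRing {ω : Ω} {t : ℝ} (hω : ω ∉ S.multipleRings t) {p q : Clock D}
    (hp : ω ∈ S.firstRing p t) (hq : ω ∈ S.firstRing q t) : p = q :=
  (eq_of_mem_shortGap (k := 0) (n := 0) hω hp hq).1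

variable [IsFiniteMeasure P]

lemma ae_mem_shortGap_of_ringsAt : ∀ᵐ ω ∂P, ∀ (p : Clock D) n k u t, k ≤ n → u ≤ t →
    RingsAt (m.rate p) (fun i => S.X (p.gap i) ω) n u → ω ∈ S.shortGap p k t := by
  filter_upwards [S.ae_X_gap_pos] with ω hgap p n k u t hkn hut hring
  exact S.shortGap_mono p k hut (hring.gap_le (fun i => (hgap p i).le) hkn)

lemma ae_exists_ringsAt : ∀ᵐ ω ∂P, ∀ (p : Clock D) t, ω ∈ S.firstRing p t →
    ∃ u ∈ Ioc 0 t, RingsAt (m.rate p) (fun i => S.X (p.gap i) ω) 0 u ∧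
      ∀ s, ω ∈ S.firstRing p s → u ≤ s := by
  filter_upwards [S.ae_X_gap_pos] with ω hgap p t hp
  have hrate : 0 < m.rate p := (m.rate_nonneg p).lt_of_ne fun h0 => by
    have hle : S.X (p.gap 0) ω ≤ m.rate p * t := hp
    rw [← h0, zero_mul] at hle
    exact hle.not_gt (hgap p 0)
  have hfirst (s : ℝ) (hs : ω ∈ S.firstRing p s) : S.X (p.gap 0) ω / m.rate p ≤ s :=
    (div_le_iff₀' hrate).2 hs
  exact ⟨S.X (p.gap 0) ω / m.rate p, ⟨div_pos (hgap p 0) hrate, hfirst t hp⟩,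
    ringsAt_zero_div _ hrate.ne', hfirst⟩

lemma ae_Z_eq_of_forall_notMem_firstRing : ∀ᵐ ω ∂P, ∀ s t, 0 ≤ s →
    (∀ l, l ≠ S.Z s ω → ω ∉ S.firstRing (.inr (S.Z s ω, l)) t) →
    ∀ u ∈ Icc s t, S.Z u ω = S.Z s ω := by
  filter_upwards [S.Z_hold, S.ae_mem_shortGap_of_ringsAt] with ω hhold hshort s t hs hno u hu
  refine hhold s u _ hs hu.1 rfl fun l hl n v hv hring => hno l hl ?_
  rw [← m.rate_switch hl] at hring
  exact hshort (.inr (S.Z s ω, l)) n 0 v t n.zero_le (hv.2.trans hu.2) hring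

lemma ae_Z_eq_of_notMem_multipleRings : ∀ᵐ ω ∂P, ∀ t l, l ≠ S.Z 0 ω →
    ω ∉ S.multipleRings t → ω ∈ S.firstRing (.inr (S.Z 0 ω, l)) t →
    S.Z t ω = l := by
  filter_upwards [S.Z_jump, S.ae_exists_ringsAt, S.ae_Z_eq_of_forall_notMem_firstRing]
    with ω hjump hexists hconst t l hl hmult hp
  obtain ⟨τ, hτ, hring, hfirst⟩ := hexists _ _ hp
  have hbefore : ∀ u ∈ Ico 0 τ, S.Z u ω = S.Z 0 ω := fun u hu => by
    refine hconst 0 u le_rfl (fun k _ hq => ?_) u ⟨hu.1, le_rfl⟩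
    have hkl := eq_of_mem_firstRing hmult (S.shortGap_mono _ 0 (hu.2.le.trans hτ.2) hq) hp
    exact (hfirst u (hkl ▸ hq)).not_gt hu.2
  have hτl : S.Z τ ω = l := by
    rw [m.rate_switch hl] at hring
    exact hjump 0 τ _ l 0 le_rfl hτ.1 hbefore hl hring
  rw [← hτl]
  refine hconst τ t hτ.1.le (fun k _ hq => hl ?_) t ⟨hτ.2, le_rfl⟩
  have hk := eq_of_mem_firstRing hmult hq hp
  simp only [Sum.inr.injEq, Prod.mk.injEq] at hk
  rw [← hτl, hk.1]

lemma ae_Z_eq_afterRing : ∀ᵐ ω ∂P, ∀ t p, 0 ≤ t → ω ∉ S.multipleRings t →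
    ω ∈ S.firstRing p t → S.Z t ω = (S.afterRing p ω).1 := by
  filter_upwards [S.ae_Z_eq_of_notMem_multipleRings, S.ae_Z_eq_of_forall_notMem_firstRing]
    with ω hswitch hconst t p ht hmult hp
  have hstay (h : ∀ l, l ≠ S.Z 0 ω → p ≠ .inr (S.Z 0 ω, l)) : S.Z t ω = S.Z 0 ω :=
    hconst 0 t le_rfl (fun l hl hq => h l hl (eq_of_mem_firstRing hmult hp hq)) t ⟨ht, le_rfl⟩
  rcases p with d | ⟨d, l⟩
  · exact hstay (by simp)
  · by_cases hd : S.Z 0 ω = d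
    · subst hd
      rcases eq_or_ne l (S.Z 0 ω) with rfl | hl
      · simpa [afterRing] using hstay (by simp +contextual [eq_comm])
      · simpa [afterRing] using hswitch t l hl hmult hp
    · rw [hstay (by simp [Ne.symm hd]), afterRing, if_neg hd]

lemma ae_hasEntered_iff : ∀ᵐ ω ∂P, ∀ t p, ω ∉ S.multipleRings t → ω ∈ S.firstRing p t →
    ∀ j, S.HasEntered j t ω ↔
      S.HasEntered j 0 ω ∨ p = .inl (S.Z 0 ω) ∧ j = .inr (S.Z 0 ω, 0) := by
  filter_upwards [S.ae_exists_ringsAt, S.ae_mem_shortGap_of_ringsAt,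
    S.ae_Z_eq_of_forall_notMem_firstRing] with ω hexists hshort hconst t p hmult hp j
  have hZ (d) (hd : p = .inl d) : ∀ u ∈ Icc 0 t, S.Z u ω = S.Z 0 ω :=
    hconst 0 t le_rfl fun l _ hq => by
      simpa [hd] using eq_of_mem_firstRing hmult hp hq
  rcases j with i | ⟨d, n⟩
  · simp [HasEntered]
  constructor
  · rintro ⟨u, hu, hring, hZu⟩
    have hpd := eq_of_mem_firstRing hmult hp (hshort (.inl d) n 0 u t n.zero_le hu.2 hring)
    have hn : n = 0 := by
      by_contra hn
      have h1 := hshort (.inl d) n 1 u t (Nat.one_le_iff_ne_zero.2 hn) hu.2 hring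
      simpa using (eq_of_mem_shortGap (k := 0) (n := 1) hmult hp h1).2
    rw [hZ d hpd u ⟨hu.1.le, hu.2⟩] at hZu
    exact .inr ⟨hZu ▸ hpd, by rw [hn, hZu]⟩
  · rintro (h0 | ⟨rfl, hj⟩)
    · exact absurd h0 (S.not_hasEntered_inr_zero _ ω)
    · obtain ⟨u, hu, hring, -⟩ := hexists _ _ hp
      simp only [Sum.inr.injEq, Prod.mk.injEq] at hj
      obtain ⟨rfl, rfl⟩ := hj
      exact ⟨u, hu, hring, hZ _ rfl u ⟨hu.1.le, hu.2⟩⟩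

lemma ae_abs_W_sub_afterRing_le : ∀ᵐ ω ∂P, ∀ t p, 0 ≤ t → ω ∉ S.multipleRings t →
    ω ∈ S.firstRing p t → |S.W t ω - (S.afterRing p ω).2| ≤ m.cMax * t := by
  filter_upwards [S.ae_exists_sum_eq_initialWorkload, S.ae_W_mem_Icc, S.ae_hasEntered_iff]
    with ω ⟨F, hF, hV⟩ hW hentered t p ht hmult hp
  suffices h : ∃ G : Finset (Customer D), (∀ j, j ∈ G ↔ S.HasEntered j t ω) ∧
      ∑ j ∈ G, S.requirement j ω = (S.afterRing p ω).2 by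
    obtain ⟨G, hG, hsum⟩ := h
    have hWG := hW G t ht hG
    rw [hsum] at hWG
    exact abs_le.2 ⟨by linarith [hWG.1], by linarith [hWG.2, mul_nonneg m.cMax_nonneg ht]⟩
  by_cases hpZ : p = .inl (S.Z 0 ω)
  · refine ⟨F.cons (.inr (S.Z 0 ω, 0)) fun h => S.not_hasEntered_inr_zero _ ω ((hF _).1 h),
      fun j => ?_, ?_⟩
    · rw [Finset.mem_cons, hF, hentered t p hmult hp, or_comm]
      simp [hpZ]
    · rw [Finset.sum_cons, hV, hpZ, add_comm]
      simp [afterRing, requirement]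
  · refine ⟨F, fun j => ?_, ?_⟩
    · rw [hF, hentered t p hmult hp]
      simp [hpZ]
    · rcases p with d | ⟨d, l⟩
      · simp only [Sum.inl.injEq] at hpZ
        simp [afterRing, hV, Ne.symm hpZ]
      · exact hV

lemma ae_drain_of_forall_notMem_firstRing : ∀ᵐ ω ∂P, ∀ t, 0 ≤ t → (∀ p, ω ∉ S.firstRing p t) →
    S.Z t ω = S.Z 0 ω ∧
      S.W t ω = max (S.initialWorkload ω - m.c (S.Z 0 ω) * t) 0 := by
  filter_upwards [S.ae_W_zero_eq_initialWorkload, S.ae_mem_shortGap_of_ringsAt,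
    S.ae_Z_eq_of_forall_notMem_firstRing, S.ae_W_eq_max] with ω hV hshort hconst hdrain t ht hno
  have hZ := hconst 0 t le_rfl fun l _ => hno _
  refine ⟨hZ t ⟨ht, le_rfl⟩, hV ▸ hdrain t ht hZ ?_⟩
  rintro (i | ⟨d, n⟩) hj
  · exact hj
  · obtain ⟨u, hu, hring, -⟩ := hj
    exact absurd (hshort (.inl d) n 0 u t n.zero_le hu.2 hring) (hno _)

end Paths

section Independence

lemma measurable_initialWorkload : Measurable S.initialWorkload :=
  (Measurable.tsum fun i => (S.init_measurable i).ennreal_ofReal).ennreal_toReal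

lemma initialWorkload_nonneg (ω : Ω) : 0 ≤ S.initialWorkload ω := ENNReal.toReal_nonneg

lemma measurable_initialState : Measurable S.initialState :=
  S.Z_zero_measurable.prodMk S.measurable_initialWorkload

lemma indepFun_initialState_X : IndepFun S.initialState (fun ω i => S.X i ω) P := by
  refine S.init_indep.comp (φ := fun x : (ℕ → ℝ) × Fin D =>
    (x.2, (∑' i, ENNReal.ofReal (x.1 i)).toReal)) (measurable_snd.prodMk ?_) measurable_id
  exact (Measurable.tsum fun i =>
    ((measurable_pi_apply i).comp measurable_fst).ennreal_ofReal).ennreal_toReal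

lemma indepFun_initialState_requirement (d : Fin D) (n : ℕ) :
    IndepFun S.initialState (S.X (.requirement d n)) P :=
  S.indepFun_initialState_X.comp measurable_id (measurable_pi_apply _)

lemma exists_measurable_afterRing_eq (p : Clock D) : ∃ f : (Fin D × ℝ) × ℝ → Fin D × ℝ,
    Measurable f ∧
      ∀ ω, S.afterRing p ω = f (S.initialState ω, S.X (.requirement p.state 0) ω) := by
  rcases p with d | ⟨d, l⟩
  · refine ⟨fun x => (x.1.1, x.1.2 + if x.1.1 = d then x.2 else 0), ?_, fun ω => rfl⟩
    have hd : MeasurableSet {x : (Fin D × ℝ) × ℝ | x.1.1 = d} :=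
      measurable_fst.fst (measurableSet_singleton d)
    exact measurable_fst.fst.prodMk
      (measurable_fst.snd.add (Measurable.ite hd measurable_snd measurable_const))
  · refine ⟨fun x => (if x.1.1 = d then l else x.1.1, x.1.2), ?_, fun ω => rfl⟩
    exact ((measurable_of_finite fun k => if k = d then l else k).comp measurable_fst.fst).prodMk
      measurable_fst.snd

lemma measurable_afterRing (p : Clock D) : Measurable (S.afterRing p) := by
  obtain ⟨f, hf, hfeq⟩ := S.exists_measurable_afterRing_eq p
  rw [funext hfeq]
  exact hf.comp (S.measurable_initialState.prodMk (S.X_measurable _))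

variable [IsProbabilityMeasure P]

lemma indepFun_gap_afterRing (p : Clock D) :
    IndepFun (S.X (p.gap 0)) (fun ω => (S.initialState ω, S.afterRing p ω)) P := by
  have hind : IndepFun (S.X (p.gap 0))
      (fun ω => (S.initialState ω, S.X (.requirement p.state 0) ω)) P :=
    indepFun_prodMk_of_indepFun_prodMk S.measurable_initialState (S.X_measurable _)
      (S.X_measurable _)
      (S.indepFun_initialState_X.comp measurable_id
        ((measurable_pi_apply (p.gap 0)).prodMk (measurable_pi_apply _)))
      (S.X_indep.indepFun (p.gap_ne_requirement 0 _ 0))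
  obtain ⟨f, hf, hfeq⟩ := S.exists_measurable_afterRing_eq p
  simp only [hfeq]
  exact hind.comp measurable_id (measurable_fst.prodMk hf)

lemma setIntegral_firstRing (p : Clock D) (t : ℝ) {g : (Fin D × ℝ) × (Fin D × ℝ) → ℝ}
    (hg : Measurable g) :
    ∫ ω in S.firstRing p t, g (S.initialState ω, S.afterRing p ω) ∂P =
      P.real (S.firstRing p t) * ∫ ω, g (S.initialState ω, S.afterRing p ω) ∂P := by
  have hone : Measurable ((Iic (m.rate p * t)).indicator (1 : ℝ → ℝ)) :=
    measurable_one.indicator measurableSet_Iic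
  have hprod := ((S.indepFun_gap_afterRing p).comp hone hg).integral_fun_mul_eq_mul_integral
    (hone.comp (S.X_measurable _)).aestronglyMeasurable
    (hg.comp (S.measurable_initialState.prodMk (S.measurable_afterRing p))).aestronglyMeasurable
  have hring := S.measurableSet_shortGap p 0 t
  rw [← integral_indicator hring, ← integral_indicator_one hring]
  refine Eq.trans (integral_congr_ae (.of_forall fun ω => ?_)) hprod
  have hmem : ω ∈ S.firstRing p t ↔ S.X (p.gap 0) ω ∈ Iic (m.rate p * t) := Iff.rfl
  by_cases hω : ω ∈ S.firstRing p t
  · simp [indicator_of_mem hω, indicator_of_mem (hmem.1 hω)]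
  · simp [indicator_of_notMem hω, indicator_of_notMem (mt hmem.2 hω)]

end Independence

/-! ### The balance of the state over a short time -/

section Balance

variable {φ : Fin D × ℝ → ℝ} {M : ℝ} {L : NNReal}

/-- The state at time `t` if no clock rings until then. -/
def drained (t : ℝ) (ω : Ω) : Fin D × ℝ :=
  (S.Z 0 ω, max (S.initialWorkload ω - m.c (S.Z 0 ω) * t) 0)

lemma measurable_drained (t : ℝ) : Measurable (S.drained t) :=
  S.Z_zero_measurable.prodMk ((S.measurable_initialWorkload.sub
    (((measurable_of_finite m.c).comp S.Z_zero_measurable).mul_const t)).max measurable_const)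

lemma abs_drained_sub_le (hL : ∀ d, LipschitzWith L fun w => φ (d, w)) {t : ℝ} (ht : 0 ≤ t)
    (ω : Ω) : |φ (S.drained t ω) - φ (S.initialState ω)| ≤ L * (m.cMax * t) := by
  have hc := mul_le_mul_of_nonneg_right (m.c_le_cMax (S.Z 0 ω)) ht
  have hc0 := mul_nonneg (m.c_nonneg (S.Z 0 ω)) ht
  refine ((hL (S.Z 0 ω)).dist_le_mul _ _).trans
    (mul_le_mul_of_nonneg_left (abs_le.2 ⟨?_, ?_⟩) L.coe_nonneg)
  · linarith [le_max_left (S.initialWorkload ω - m.c (S.Z 0 ω) * t) 0]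
  · linarith [max_le (a := S.initialWorkload ω - m.c (S.Z 0 ω) * t) (b := 0)
      (c := S.initialWorkload ω) (by linarith) (S.initialWorkload_nonneg ω),
      mul_nonneg m.cMax_nonneg ht]

/-- The change of `φ` in `[0, t]` that is not explained by the drain and by the first rings of the
clocks. -/
def remainder (φ : Fin D × ℝ → ℝ) (t : ℝ) (ω : Ω) : ℝ :=
  φ (S.Z t ω, S.W t ω) - φ (S.drained t ω) -
    ∑ p, (S.firstRing p t).indicator (fun ω => φ (S.afterRing p ω) - φ (S.initialState ω)) ω

lemma abs_remainder_le (hM : ∀ x, |φ x| ≤ M) (t : ℝ) (ω : Ω) :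
    |S.remainder φ t ω| ≤ 2 * M + Fintype.card (Clock D) * (2 * M) := by
  have hdiff (x y) : |φ x - φ y| ≤ 2 * M := (abs_sub _ _).trans (by linarith [hM x, hM y])
  have hterm (p : Clock D) : |(S.firstRing p t).indicator
      (fun ω => φ (S.afterRing p ω) - φ (S.initialState ω)) ω| ≤ 2 * M :=
    (norm_indicator_le_norm_self (fun ω => φ (S.afterRing p ω) - φ (S.initialState ω)) ω).trans
      (hdiff _ _)
  refine (abs_sub _ _).trans (add_le_add (hdiff _ _) ((Finset.abs_sum_le_sum_abs _ _).trans ?_))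
  simpa using Finset.sum_le_card_nsmul Finset.univ _ _ fun p _ => hterm p

variable {S} in
lemma IsStationary.identDistrib_initialState (hS : S.IsStationary) {t : ℝ} (ht : 0 ≤ t) :
    IdentDistrib (fun ω => (S.Z t ω, S.W t ω)) S.initialState P P := by
  refine ((hS t ht).comp measurable_swap).trans (.of_ae_eq ?_ ?_)
  · exact (hS 0 le_rfl).comp measurable_swap |>.aemeasurable_fst
  · filter_upwards [S.ae_W_zero_eq_initialWorkload] with ω hω
    simp [initialState, hω]

variable [IsProbabilityMeasure P]

lemma ae_abs_remainder_le (hL : ∀ d, LipschitzWith L fun w => φ (d, w)) :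
    ∀ᵐ ω ∂P, ∀ t, 0 ≤ t → ω ∉ S.multipleRings t →
      |S.remainder φ t ω| ≤ 2 * L * m.cMax * t * ∑ p, (S.firstRing p t).indicator 1 ω := by
  filter_upwards [S.ae_drain_of_forall_notMem_firstRing, S.ae_Z_eq_afterRing,
    S.ae_abs_W_sub_afterRing_le] with ω hdrain hZ hW t ht hmult
  by_cases hex : ∃ p, ω ∈ S.firstRing p t
  · obtain ⟨p, hp⟩ := hex
    have hne (f : Clock D → Ω → ℝ) (q) (hq : q ≠ p) : (S.firstRing q t).indicator (f q) ω = 0 :=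
      indicator_of_notMem (fun hq' => hq (eq_of_mem_firstRing hmult hq' hp)) _
    rw [remainder, Fintype.sum_eq_single p (hne _), Fintype.sum_eq_single p (hne _),
      indicator_of_mem hp, indicator_of_mem hp]
    have hafter : |φ (S.Z t ω, S.W t ω) - φ (S.afterRing p ω)| ≤ L * (m.cMax * t) := by
      rw [hZ t p ht hmult hp]
      exact ((hL _).dist_le_mul _ _).trans
        (mul_le_mul_of_nonneg_left (hW t p ht hmult hp) L.coe_nonneg)
    calc _ = |φ (S.Z t ω, S.W t ω) - φ (S.afterRing p ω) -
          (φ (S.drained t ω) - φ (S.initialState ω))| := by ring_nf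
      _ ≤ _ := (abs_sub _ _).trans (add_le_add hafter (S.abs_drained_sub_le hL ht ω))
      _ = _ := by rw [Pi.one_apply]; ring
  · push Not at hex
    obtain ⟨hZt, hWt⟩ := hdrain t ht hex
    simp [remainder, drained, hZt, hWt, indicator_of_notMem, hex]

lemma integrable_comp_of_abs_le (hφ : Measurable φ) (hM : ∀ x, |φ x| ≤ M) {Y : Ω → Fin D × ℝ}
    (hY : AEMeasurable Y P) : Integrable (fun ω => φ (Y ω)) P :=
  .of_bound (hφ.comp_aemeasurable hY).aestronglyMeasurable M (.of_forall fun ω => hM (Y ω))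

lemma integrable_afterRing_sub (hφ : Measurable φ) (hM : ∀ x, |φ x| ≤ M) (p : Clock D) :
    Integrable (fun ω => φ (S.afterRing p ω) - φ (S.initialState ω)) P :=
  (integrable_comp_of_abs_le hφ hM (S.measurable_afterRing p).aemeasurable).sub
    (integrable_comp_of_abs_le hφ hM S.measurable_initialState.aemeasurable)

variable {S} in
lemma IsStationary.integral_remainder (hS : S.IsStationary) (hφ : Measurable φ)
    (hM : ∀ x, |φ x| ≤ M) {t : ℝ} (ht : 0 ≤ t) :
    ∫ ω, S.remainder φ t ω ∂P = ∫ ω, φ (S.initialState ω) ∂P - ∫ ω, φ (S.drained t ω) ∂P -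
      ∑ p, P.real (S.firstRing p t) * ∫ ω, (φ (S.afterRing p ω) - φ (S.initialState ω)) ∂P := by
  have hident := hS.identDistrib_initialState ht
  have hring (p) := S.measurableSet_shortGap p 0 t
  have hint (p) := (S.integrable_afterRing_sub hφ hM p).indicator (hring p)
  have hstate := integrable_comp_of_abs_le hφ hM (P := P) hident.aemeasurable_fst
  have hdrained := integrable_comp_of_abs_le hφ hM (P := P) (S.measurable_drained t).aemeasurable
  have hstat : ∫ ω, φ (S.Z t ω, S.W t ω) ∂P = ∫ ω, φ (S.initialState ω) ∂P :=
    (hident.comp hφ).integral_eq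
  have hdiff : Integrable (fun ω => φ (S.Z t ω, S.W t ω) - φ (S.drained t ω)) P :=
    hstate.sub hdrained
  simp only [remainder]
  rw [integral_sub hdiff (integrable_finsetSum _ fun p _ => hint p),
    integral_sub hstate hdrained, hstat, integral_finsetSum _ fun p _ => hint p]
  refine congrArg _ (Finset.sum_congr rfl fun p _ => ?_)
  rw [integral_indicator (hring p)]
  exact S.setIntegral_firstRing p t (g := fun x => φ x.2 - φ x.1)
    ((hφ.comp measurable_snd).sub (hφ.comp measurable_fst))

lemma exists_ae_abs_remainder_le (hM : ∀ x, |φ x| ≤ M)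
    (hL : ∀ d, LipschitzWith L fun w => φ (d, w)) :
    ∃ C, 0 ≤ C ∧ ∀ᵐ ω ∂P, ∀ t, 0 ≤ t → |S.remainder φ t ω| ≤
      C * (S.multipleRings t).indicator 1 ω + C * t * ∑ p, (S.firstRing p t).indicator 1 ω := by
  have hc := m.cMax_nonneg
  have hM0 : 0 ≤ M := by
    obtain ⟨ω⟩ := nonempty_of_isProbabilityMeasure P
    exact (abs_nonneg _).trans (hM (S.initialState ω))
  set C₁ := 2 * M + Fintype.card (Clock D) * (2 * M)
  set C₂ := 2 * L * m.cMax
  have hC₁ : 0 ≤ C₁ := by positivity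
  have hC₂ : 0 ≤ C₂ := by positivity
  refine ⟨C₁ + C₂, by positivity, ?_⟩
  filter_upwards [S.ae_abs_remainder_le hL] with ω hω t ht
  have hrings : 0 ≤ ∑ p, (S.firstRing p t).indicator (1 : Ω → ℝ) ω :=
    Finset.sum_nonneg fun p _ => indicator_nonneg (by simp) ω
  by_cases hmult : ω ∈ S.multipleRings t
  · rw [indicator_of_mem hmult, Pi.one_apply, mul_one]
    have := S.abs_remainder_le hM t ω
    have : 0 ≤ (C₁ + C₂) * t * ∑ p, (S.firstRing p t).indicator (1 : Ω → ℝ) ω := by positivity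
    linarith
  · rw [indicator_of_notMem hmult, mul_zero, zero_add]
    refine (hω t ht hmult).trans ?_
    gcongr
    exact le_add_of_nonneg_left hC₁

lemma exists_abs_integral_remainder_le (hM : ∀ x, |φ x| ≤ M)
    (hL : ∀ d, LipschitzWith L fun w => φ (d, w)) :
    ∃ K, ∀ t, 0 ≤ t → |∫ ω, S.remainder φ t ω ∂P| ≤ K * t ^ 2 := by
  obtain ⟨K, hK⟩ := S.exists_measureReal_multipleRings_le
  obtain ⟨C, hC, hbound⟩ := S.exists_ae_abs_remainder_le hM hL
  refine ⟨C * K + C * ∑ p, m.rate p, fun t ht => ?_⟩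
  have hmult := S.measurableSet_multipleRings t
  have hring (p) := S.measurableSet_shortGap p 0 t
  have hint {A : Set Ω} (hA : MeasurableSet A) : Integrable (A.indicator (1 : Ω → ℝ)) P :=
    (integrable_const (1 : ℝ)).indicator hA
  have hintm : Integrable (fun ω => C * (S.multipleRings t).indicator 1 ω) P :=
    (hint hmult).const_mul C
  have hintr : Integrable (fun ω => C * t * ∑ p, (S.firstRing p t).indicator 1 ω) P :=
    (integrable_finsetSum _ fun p _ => hint (hring p)).const_mul _
  calc |∫ ω, S.remainder φ t ω ∂P|
      ≤ ∫ ω, C * (S.multipleRings t).indicator 1 ω +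
          C * t * ∑ p, (S.firstRing p t).indicator 1 ω ∂P :=
        norm_integral_le_of_norm_le (f := S.remainder φ t) (hintm.add hintr)
          (hbound.mono fun ω hω => hω t ht)
    _ = C * P.real (S.multipleRings t) + C * t * ∑ p, P.real (S.firstRing p t) := by
        rw [integral_add hintm hintr, integral_const_mul, integral_const_mul,
          integral_finsetSum _ fun p _ => hint (hring p), integral_indicator_one hmult]
        simp only [integral_indicator_one (hring _)]
    _ ≤ C * (K * t ^ 2) + C * t * ∑ p, m.rate p * t := by
        gcongr with p
        · exact hK t ht
        · exact S.measureReal_shortGap_le p 0 ht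
    _ = (C * K + C * ∑ p, m.rate p) * t ^ 2 := by
        rw [← Finset.sum_mul]
        ring

variable {S} in
theorem IsStationary.tendsto_inv_mul_integral_drained_sub (hS : S.IsStationary) (hφ : Measurable φ)
    (hM : ∀ x, |φ x| ≤ M) (hL : ∀ d, LipschitzWith L fun w => φ (d, w)) :
    Tendsto (fun t => t⁻¹ * (∫ ω, φ (S.drained t ω) ∂P - ∫ ω, φ (S.initialState ω) ∂P)) (𝓝[>] 0)
      (𝓝 (-∑ p, m.rate p * ∫ ω, (φ (S.afterRing p ω) - φ (S.initialState ω)) ∂P)) := by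
  obtain ⟨K, hK⟩ := S.exists_abs_integral_remainder_le hM hL
  have hremainder : Tendsto (fun t => t⁻¹ * ∫ ω, S.remainder φ t ω ∂P) (𝓝[>] 0) (𝓝 0) := by
    have hlin : Tendsto (fun t : ℝ => K * t) (𝓝[>] 0) (𝓝 0) :=
      ((continuous_const_mul K).tendsto' 0 0 (mul_zero K)).mono_left nhdsWithin_le_nhds
    refine squeeze_zero_norm' ?_ hlin
    filter_upwards [self_mem_nhdsWithin] with t (ht : 0 < t)
    rw [norm_mul, norm_inv, Real.norm_of_nonneg ht.le, inv_mul_le_iff₀ ht]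
    exact (hK t ht.le).trans_eq (by ring)
  have hrings : Tendsto (fun t => ∑ p, t⁻¹ * P.real (S.firstRing p t) *
      ∫ ω, (φ (S.afterRing p ω) - φ (S.initialState ω)) ∂P) (𝓝[>] 0)
      (𝓝 (∑ p, m.rate p * ∫ ω, (φ (S.afterRing p ω) - φ (S.initialState ω)) ∂P)) :=
    tendsto_finsetSum _ fun p _ => (S.tendsto_inv_mul_measureReal_firstRing p).mul_const _
  have hsum := (hremainder.add hrings).neg
  rw [zero_add] at hsum
  refine hsum.congr' ?_
  filter_upwards [self_mem_nhdsWithin] with t (ht : 0 < t)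
  rw [hS.integral_remainder hφ hM ht.le]
  simp only [mul_assoc, ← Finset.mul_sum]
  ring

end Balance

end Realization

/-! ### The transform of the workload in steady state -/

section TestFunction

variable {l : Fin D} {s : ℝ}

/-- The test function `(z, w) ↦ 1_{z = l} exp (s w)`, whose expectations give the transform of the
workload in state `l`. It is cut off at negative `w` so as to be bounded and Lipschitz for
`s ≤ 0`. -/
def stateExp (l : Fin D) (s : ℝ) (x : Fin D × ℝ) : ℝ :=
  if x.1 = l then Real.exp (s * max x.2 0) else 0

lemma measurable_stateExp : Measurable (stateExp l s) :=
  .ite (measurable_fst (measurableSet_singleton l)) (by fun_prop) measurable_const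

lemma abs_stateExp_le_one (hs : s ≤ 0) (x : Fin D × ℝ) : |stateExp l s x| ≤ 1 := by
  have hexp := Real.exp_le_one_iff.2 (mul_nonpos_of_nonpos_of_nonneg hs (le_max_right x.2 0))
  rw [stateExp]
  split_ifs <;> simp [hexp]

lemma lipschitzWith_stateExp (hs : s ≤ 0) (d : Fin D) :
    LipschitzWith ‖s‖₊ fun w => stateExp l s (d, w) := by
  by_cases hd : d = l
  · simpa [stateExp, hd] using lipschitzWith_exp_mul_max hs
  · simpa [stateExp, hd] using (LipschitzWith.const (0 : ℝ)).weaken (zero_le (a := ‖s‖₊))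

end TestFunction

namespace Realization

variable {m} {Ω : Type*} [MeasurableSpace Ω] {P : Measure Ω} (S : m.Realization P) {s : ℝ}

/-- The restriction of `P` to the event `Z 0 = l`. -/
abbrev stateMeasure (l : Fin D) : Measure Ω := P.restrict (S.Z 0 ⁻¹' {l})

/-- The transform `E[exp (s W); Z = l]` of the workload in steady state. -/
def transform (l : Fin D) (s : ℝ) : ℝ := mgf S.initialWorkload (S.stateMeasure l) s

lemma integral_ite_Z_eq (l : Fin D) (f : Ω → ℝ) :
    ∫ ω, (if S.Z 0 ω = l then f ω else 0) ∂P = ∫ ω, f ω ∂S.stateMeasure l := by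
  rw [← integral_indicator (S.Z_zero_measurable (measurableSet_singleton l))]
  exact integral_congr_ae (.of_forall fun ω => by simp [indicator])

lemma integral_stateExp_initialState (l : Fin D) (s : ℝ) :
    ∫ ω, stateExp l s (S.initialState ω) ∂P = S.transform l s := by
  simp only [stateExp, initialState, max_eq_left (S.initialWorkload_nonneg _)]
  exact S.integral_ite_Z_eq l _

lemma integral_stateExp_drained (l : Fin D) (s t : ℝ) :
    ∫ ω, stateExp l s (S.drained t ω) ∂P =
      mgf (fun ω => max (S.initialWorkload ω - m.c l * t) 0) (S.stateMeasure l) s := by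
  rw [mgf, ← S.integral_ite_Z_eq]
  refine integral_congr_ae (.of_forall fun ω => ?_)
  by_cases hl : S.Z 0 ω = l <;> simp [stateExp, drained, hl]

lemma stateExp_afterRing_switch_sub (l d k : Fin D) (s : ℝ) (ω : Ω) :
    stateExp l s (S.afterRing (.inr (d, k)) ω) - stateExp l s (S.initialState ω) =
      ((if k = l then 1 else 0) - if d = l then 1 else 0) * stateExp d s (S.initialState ω) := by
  by_cases hd : S.Z 0 ω = d
  · simp [stateExp, afterRing, initialState, hd, sub_mul]
  · rw [afterRing, if_neg hd, initialState, sub_self, stateExp, if_neg hd, mul_zero]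

lemma integral_stateExp_afterRing_switch_sub (l d k : Fin D) :
    ∫ ω, (stateExp l s (S.afterRing (.inr (d, k)) ω) - stateExp l s (S.initialState ω)) ∂P =
      ((if k = l then 1 else 0) - if d = l then 1 else 0) * S.transform d s := by
  simp only [stateExp_afterRing_switch_sub, integral_const_mul, integral_stateExp_initialState]

lemma rate_switch_mul_sub (l d k : Fin D) :
    m.rate (.inr (d, k)) * ((if k = l then 1 else 0) - if d = l then 1 else 0) =
      m.Q d k * ((if k = l then 1 else 0) - if d = l then 1 else 0) := by
  by_cases hk : k = d
  · simp [hk]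
  · rw [m.rate_switch hk]

lemma measureReal_initialWorkload_eq_zero [IsFiniteMeasure P] (l : Fin D) :
    (S.stateMeasure l).real {ω | S.initialWorkload ω = 0} = S.p0 l := by
  have h0 : MeasurableSet {ω | S.initialWorkload ω = 0} :=
    S.measurable_initialWorkload (measurableSet_singleton 0)
  rw [measureReal_restrict_apply h0, p0]
  refine measureReal_congr ?_
  filter_upwards [S.ae_W_zero_eq_initialWorkload] with ω hω
  exact congrArg (· = 0 ∧ S.Z 0 ω = l) hω.symm |>.to_iff.eq

lemma mgf_initialWorkload_eq_sum [IsFiniteMeasure P] (hs : s ≤ 0) :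
    mgf S.initialWorkload P s = ∑ l, S.transform l s := by
  have hunion : ⋃ l, S.Z 0 ⁻¹' {l} = univ := by ext; simp
  have hexp := integrable_exp_mul_of_nonpos (μ := P) S.measurable_initialWorkload.aemeasurable
    (.of_forall S.initialWorkload_nonneg) hs
  rw [mgf, ← setIntegral_univ, ← hunion, integral_iUnion_fintype
    (fun l => S.Z_zero_measurable (measurableSet_singleton l))
    (fun k l hkl => (disjoint_singleton.2 hkl).preimage _) fun l => hexp.integrableOn]
  rfl

section Balance

variable [IsProbabilityMeasure P]

lemma integral_exp_requirement_sub_one (hs : s ≤ 0) (l : Fin D) :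
    ∫ ω, (Real.exp (s * S.X (.requirement l 0) ω) - 1) ∂P = mgf id (m.H l) s - 1 := by
  have hX := S.X_measurable (.requirement l 0)
  rw [← mgf_sub_measureReal_univ hX.aemeasurable (S.ae_X_requirement_nonneg.mono fun ω hω => hω l 0)
    hs, probReal_univ, ← mgf_id_map hX.aemeasurable, S.X_law]
  rfl

lemma integral_stateExp_afterRing_interarrival_sub (hs : s ≤ 0) (l d : Fin D) :
    ∫ ω, (stateExp l s (S.afterRing (.inl d) ω) - stateExp l s (S.initialState ω)) ∂P =
      if d = l then (mgf id (m.H l) s - 1) * S.transform l s else 0 := by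
  split_ifs with hd
  · subst hd
    have hindep := (S.indepFun_initialState_requirement d 0).comp
      (measurable_stateExp (l := d) (s := s))
      (by fun_prop : Measurable fun x => Real.exp (s * x) - 1)
    have hprod := hindep.integral_fun_mul_eq_mul_integral
      (measurable_stateExp.comp S.measurable_initialState).aestronglyMeasurable
      (((S.X_measurable _).const_mul s).exp.sub_const 1).aestronglyMeasurable
    simp only [Function.comp_apply, S.integral_stateExp_initialState,
      S.integral_exp_requirement_sub_one hs] at hprod
    rw [mul_comm, ← hprod]
    refine integral_congr_ae ?_
    filter_upwards [S.ae_X_requirement_nonneg] with ω hω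
    have hV := S.initialWorkload_nonneg ω
    by_cases hd : S.Z 0 ω = d
    · simp [stateExp, afterRing, initialState, hd, hV, add_nonneg hV (hω d 0), mul_add,
        Real.exp_add, mul_sub]
    · simp [stateExp, afterRing, initialState, hd]
  · refine integral_eq_zero_of_ae (.of_forall fun ω => ?_)
    by_cases hl : S.Z 0 ω = l
    · simp [stateExp, afterRing, initialState, hl, Ne.symm hd]
    · simp [stateExp, afterRing, initialState, hl]

lemma sum_rate_mul_integral_stateExp_afterRing_sub (hs : s ≤ 0) (l : Fin D) :
    ∑ p, m.rate p *
        ∫ ω, (stateExp l s (S.afterRing p ω) - stateExp l s (S.initialState ω)) ∂P =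
      m.lam l * (mgf id (m.H l) s - 1) * S.transform l s + ∑ d, S.transform d s * m.Q d l := by
  rw [Fintype.sum_sum_type, Fintype.sum_prod_type]
  simp only [S.integral_stateExp_afterRing_interarrival_sub hs,
    integral_stateExp_afterRing_switch_sub, ← mul_assoc, rate_switch_mul_sub]
  congr 1
  · simp [rate, mul_assoc]
  · refine Finset.sum_congr rfl fun d _ => ?_
    rw [← Finset.sum_mul, mul_comm]
    simp [mul_sub, Finset.sum_sub_distrib, m.Q_rowSum]

variable {S} in
theorem IsStationary.sum_transform_mul_Q (hS : S.IsStationary) (hs : s ≤ 0) (l : Fin D) :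
    ∑ d, S.transform d s * m.Q d l =
      s * m.c l * (S.transform l s - S.p0 l) -
        m.lam l * (mgf id (m.H l) s - 1) * S.transform l s := by
  have hrings := hS.tendsto_inv_mul_integral_drained_sub (measurable_stateExp (l := l))
    (abs_stateExp_le_one hs) (lipschitzWith_stateExp hs)
  have hdrain := tendsto_inv_mul_mgf_drain_sub (μ := S.stateMeasure l) S.measurable_initialWorkload
    (.of_forall S.initialWorkload_nonneg) hs (m.c_nonneg l)
  simp only [S.integral_stateExp_drained, S.integral_stateExp_initialState,
    S.sum_rate_mul_integral_stateExp_afterRing_sub hs] at hrings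
  rw [S.measureReal_initialWorkload_eq_zero] at hdrain
  have := tendsto_nhds_unique hrings hdrain
  rw [← transform] at this
  linarith

end Balance

end Realization

section Requirement

variable {m}

lemma ae_H_nonneg (m : ModulatedQueue D) (l : Fin D) : 0 ≤ᵐ[m.H l] id := by
  simpa [EventuallyLE, ae_iff, Iio] using m.H_nonneg l

/-- The quotient `(E[exp (s B)] - 1) / s` for a service requirement `B` with law `H l`; its limit at
`s = 0` is the first moment of `B`. -/
def mgfQuotient (m : ModulatedQueue D) (l : Fin D) (s : ℝ) : ℝ := s⁻¹ * (mgf id (m.H l) s - 1)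

lemma tendsto_mgfQuotient (l : Fin D) : Tendsto (m.mgfQuotient l) (𝓝[<] 0) (𝓝 (m.h1 l)) := by
  have := m.H_prob l
  have hlim := tendsto_inv_mul_mgf_sub (m.ae_H_nonneg l) (m.H_first l)
  rw [probReal_univ] at hlim
  exact hlim

lemma tendsto_inv_mul_mgfQuotient_sub (l : Fin D) :
    Tendsto (fun s => s⁻¹ * (m.mgfQuotient l s - m.h1 l)) (𝓝[<] 0) (𝓝 (m.h2 l / 2)) := by
  have := m.H_prob l
  have hmem : MemLp id 2 (m.H l) :=
    (memLp_two_iff_integrable_sq aestronglyMeasurable_id).2 (m.H_second l)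
  refine (tendsto_inv_sq_mul_mgf_sub (m.ae_H_nonneg l) hmem).congr' ?_
  filter_upwards [self_mem_nhdsWithin] with s (hs : s < 0)
  have := hs.ne
  rw [probReal_univ, mgfQuotient, h1]
  simp only [id]
  field_simp

end Requirement

namespace Realization

namespace IsStationary

variable {m} {Ω : Type*} [MeasurableSpace Ω] {P : Measure Ω} [IsProbabilityMeasure P]
  {S : m.Realization P} {π a : Fin D → ℝ} {s : ℝ}

lemma isInvariantDistribution_transform_zero (hS : S.IsStationary) :
    m.IsInvariantDistribution fun l => S.transform l 0 := by
  refine ⟨fun l => mgf_nonneg, ?_, fun l => ?_⟩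
  · rw [← S.mgf_initialWorkload_eq_sum le_rfl, mgf_zero]
  · have := m.H_prob l
    simp [hS.sum_transform_mul_Q le_rfl]

lemma tendsto_transform (hS : S.IsStationary) (hπ : m.IsInvariantDistribution π) (l : Fin D) :
    Tendsto (S.transform l) (𝓝[<] 0) (𝓝 (π l)) := by
  have hπl : π l = (S.stateMeasure l).real univ := by
    rw [← hπ.unique hS.isInvariantDistribution_transform_zero, ← mgf_zero' (X := S.initialWorkload)]
    rfl
  rw [hπl]
  exact tendsto_mgf_nhdsLT_zero S.measurable_initialWorkload.aemeasurable
    (.of_forall S.initialWorkload_nonneg)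

lemma sum_transform_mul_sum_Q_mul (hS : S.IsStationary) (hs : s < 0) (a : Fin D → ℝ) :
    ∑ d, S.transform d s * ∑ l, m.Q d l * a l =
      s * ∑ l, a l *
        ((m.c l - m.lam l * m.mgfQuotient l s) * S.transform l s - m.c l * S.p0 l) := by
  calc _ = ∑ l, a l * ∑ d, S.transform d s * m.Q d l := by
        simp only [Finset.mul_sum]
        rw [Finset.sum_comm]
        exact Finset.sum_congr rfl fun l _ => Finset.sum_congr rfl fun d _ => by ring
    _ = _ := by
        rw [Finset.mul_sum]
        refine Finset.sum_congr rfl fun l _ => ?_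
        have := hs.ne
        rw [hS.sum_transform_mul_Q hs.le, mgfQuotient]
        field_simp
        ring

lemma sum_c_mul_p0_eq_sum_transform (hS : S.IsStationary) (hs : s < 0) :
    ∑ l, m.c l * S.p0 l = ∑ l, (m.c l - m.lam l * m.mgfQuotient l s) * S.transform l s := by
  have h := hS.sum_transform_mul_sum_Q_mul hs 1
  simp only [Pi.one_apply, mul_one, m.Q_rowSum, mul_zero, Finset.sum_const_zero, one_mul,
    Finset.sum_sub_distrib] at h
  linarith [(mul_eq_zero.1 h.symm).resolve_left hs.ne]

theorem cInf_mul_one_sub_rhoInf (hS : S.IsStationary) (hπ : m.IsInvariantDistribution π)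
    (hc : m.cInf π ≠ 0) : m.cInf π * (1 - m.rhoInf π) = ∑ l, m.c l * S.p0 l := by
  have hlim := tendsto_finsetSum Finset.univ fun l _ =>
    (((tendsto_mgfQuotient (m := m) l).const_mul (m.lam l)).const_sub (m.c l)).mul
      (hS.tendsto_transform hπ l)
  rw [ModulatedQueue.cInf_mul_one_sub_rhoInf hc]
  simp only [mul_comm (π _)]
  refine tendsto_nhds_unique hlim (tendsto_const_nhds.congr' ?_)
  filter_upwards [self_mem_nhdsWithin] with s hs using hS.sum_c_mul_p0_eq_sum_transform hs

lemma sum_mul_p0_mul_inv_mul_mgf_sub_one (hS : S.IsStationary) (hs : s < 0)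
    (ha : ∀ d, ∑ l, m.Q d l * a l = m.c d - m.lam d * m.h1 d - ∑ l, m.c l * S.p0 l) :
    (∑ l, m.c l * S.p0 l) * (s⁻¹ * (mgf S.initialWorkload P s - 1)) =
      ∑ l, (m.lam l * (s⁻¹ * (m.mgfQuotient l s - m.h1 l)) * S.transform l s +
        a l * ((m.lam l * m.mgfQuotient l s - m.c l) * S.transform l s + m.c l * S.p0 l)) := by
  have hbal := hS.sum_transform_mul_sum_Q_mul hs a
  have hzero := hS.sum_c_mul_p0_eq_sum_transform hs
  simp only [ha] at hbal
  set κ := ∑ l, m.c l * S.p0 l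
  symm
  calc _ = s⁻¹ * (∑ l, m.lam l * (m.mgfQuotient l s - m.h1 l) * S.transform l s -
        s * ∑ l, a l *
          ((m.c l - m.lam l * m.mgfQuotient l s) * S.transform l s - m.c l * S.p0 l)) := by
        rw [mul_sub, inv_mul_cancel_left₀ hs.ne, Finset.mul_sum, ← Finset.sum_sub_distrib]
        exact Finset.sum_congr rfl fun l _ => by ring
    _ = s⁻¹ * (κ * ∑ l, S.transform l s -
        ∑ l, (m.c l - m.lam l * m.mgfQuotient l s) * S.transform l s) := by
        rw [← hbal, Finset.mul_sum, ← Finset.sum_sub_distrib, ← Finset.sum_sub_distrib]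
        exact congrArg _ (Finset.sum_congr rfl fun l _ => by ring)
    _ = _ := by
        rw [← hzero, ← S.mgf_initialWorkload_eq_sum hs.le]
        ring

lemma tendsto_inv_mul_mgf_sub_one (hS : S.IsStationary) (hπ : m.IsInvariantDistribution π)
    (hκ : ∑ l, m.c l * S.p0 l ≠ 0)
    (ha : ∀ d, ∑ l, m.Q d l * a l = m.c d - m.lam d * m.h1 d - ∑ l, m.c l * S.p0 l) :
    Tendsto (fun s => s⁻¹ * (mgf S.initialWorkload P s - 1)) (𝓝[<] 0)
      (𝓝 ((∑ l, (m.lam l * (m.h2 l / 2) * π l +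
        a l * ((m.lam l * m.h1 l - m.c l) * π l + m.c l * S.p0 l))) /
          ∑ l, m.c l * S.p0 l)) := by
  have hlim := tendsto_finsetSum Finset.univ fun l _ =>
    (((tendsto_inv_mul_mgfQuotient_sub (m := m) l).const_mul (m.lam l)).mul
      (hS.tendsto_transform hπ l)).add
    ((((((tendsto_mgfQuotient (m := m) l).const_mul (m.lam l)).sub_const (m.c l)).mul
      (hS.tendsto_transform hπ l)).add_const (m.c l * S.p0 l)).const_mul (a l))
  refine (hlim.div_const (∑ l, m.c l * S.p0 l)).congr' ?_
  filter_upwards [self_mem_nhdsWithin] with s hs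
  rw [← hS.sum_mul_p0_mul_inv_mul_mgf_sub_one hs ha, mul_div_cancel_left₀ _ hκ]

theorem integrable_initialWorkload_and_integral_eq (hS : S.IsStationary)
    (hπ : m.IsInvariantDistribution π) (hκ : ∑ l, m.c l * S.p0 l ≠ 0)
    (ha : ∀ d, ∑ l, m.Q d l * a l = m.c d - m.lam d * m.h1 d - ∑ l, m.c l * S.p0 l) :
    Integrable S.initialWorkload P ∧ ∫ ω, S.initialWorkload ω ∂P =
      (∑ l, (m.lam l * (m.h2 l / 2) * π l +
        a l * ((m.lam l * m.h1 l - m.c l) * π l + m.c l * S.p0 l))) / ∑ l, m.c l * S.p0 l := by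
  have hlim := hS.tendsto_inv_mul_mgf_sub_one hπ hκ ha
  rw [← probReal_univ (μ := P)] at hlim
  have hV : 0 ≤ᵐ[P] S.initialWorkload := .of_forall S.initialWorkload_nonneg
  have hint := integrable_of_tendsto_inv_mul_mgf_sub S.measurable_initialWorkload.aemeasurable hV
    hlim
  exact ⟨hint, tendsto_nhds_unique (tendsto_inv_mul_mgf_sub hV hint) hlim⟩

end IsStationary

end Realization

end ModulatedQueue

end

theorem mainTheorem3 {D : ℕ} (m : ModulatedQueue D) (π : Fin D → ℝ)
    (hπ : m.IsInvariantDistribution π) (hc : 0 < m.cInf π)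
    {Ω : Type*} [MeasurableSpace Ω] (P : Measure Ω) [IsProbabilityMeasure P]
    (S : m.Realization P) (hS : S.IsStationary) :
    1 - m.rhoInf π = ∑ d, S.p0 d * m.c d / m.cInf π ∧
    (∃ a : Fin D → ℝ, m.SolvesQ π a) ∧
    (m.rhoInf π < 1 → ∀ a : Fin D → ℝ, m.SolvesQ π a →
      Integrable (S.W 0) P ∧
      ∫ ω, S.W 0 ω ∂P =
        (∑ d, (π d * m.lam d * m.h2 d / 2 + a d * π d * (m.lam d * m.h1 d - m.c d)
          + S.p0 d * m.c d * a d)) / (m.cInf π * (1 - m.rhoInf π))) := by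
  have hκ := hS.cInf_mul_one_sub_rhoInf hπ hc.ne'
  refine ⟨?_, ModulatedQueue.exists_solvesQ hπ hc.ne', fun hρ a ha => ?_⟩
  · simp only [mul_comm (S.p0 _)]
    rw [← Finset.sum_div, ← hκ, mul_div_cancel_left₀ _ hc.ne']
  · have hκ_pos : 0 < m.cInf π * (1 - m.rhoInf π) := mul_pos hc (sub_pos.2 hρ)
    simp only [ModulatedQueue.SolvesQ, hκ] at ha hκ_pos
    obtain ⟨hint, hmean⟩ := hS.integrable_initialWorkload_and_integral_eq hπ hκ_pos.ne' ha
    refine ⟨hint.congr S.ae_W_zero_eq_initialWorkload.symm, ?_⟩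
    rw [integral_congr_ae S.ae_W_zero_eq_initialWorkload, hmean, hκ]
    exact congrArg (· / _) (Finset.sum_congr rfl fun d _ => by ring)
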